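/- All groups are finite. A subgroup $N$ of a group $G$ \emph{has a complement} in $G$ if there is a subgroup $K\le G$ with $G=NK$ and $N\cap K=1$. Write $\mathrm{Z}(N)$ for the center of $N$, $\mathrm{Inn}(N)\le\mathrm{Aut}(N)$ for the group of inner automorphisms and $\mathrm{Out}(N)=\mathrm{Aut}(N)/\mathrm{Inn}(N)$. We say that \emph{Rose's criterion holds for} $N$ (or that $N$ fulfills Rose's criterion) if $\mathrm{Z}(N)=1$ and $\mathrm{Inn}(N)$ has a complement in $\mathrm{Aut}(N)$. We say that \emph{Gaschütz' theorem holds for} $N$ if for every finite group $G$ and every embedding $N\le H\le G$ such that $N\unlhd G$, $\gcd(|N|,|G:H|)=1$ and $N$ has a complement in $H$, it follows that $N$ has a complement in $G$. Then: (i) Let $N_1,\ldots,N_k$ be finite groups. Then Rose's criterion holds for $N_1\times\cdots\times N_k$ if and only if it holds for each of $N_1,\ldots,N_k$. (ii) Let $N$ be a finite group that is the (internal) direct product $N=N_1\times\cdots\times N_k$ of characteristic subgroups $N_1,\ldots,N_k\le N$. If Gaschütz' theorem holds for each of $N_1,\ldots,N_k$, then Gaschütz' theorem holds for $N$. (iii)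 Let $N$ be a finite group with a characteristic subgroup $M$ such that $M$ fulfills Rose's criterion and Gaschütz' theorem holds for $N/M$. Then Gaschütz' theorem holds for $N$. (iv) Let $N$ be a finite group with a characteristic subgroup $M$ such that $\gcd(|M|,|\mathrm{Z}(N)|\,|\mathrm{Out}(N)|)=1$ and all Sylow subgroups of $M$ are abelian. Suppose that $M$ has a complement in $N$ and that Gaschütz' theorem holds for $N/M$. Then Gaschütz' theorem holds for $N$. -/

import Mathlib

universe u v

/-- The subgroup `N` of `G` has a complement in `G`: a subgroup `K` with `G = N K` and
`N ∩ K = 1` (equivalently, every `g : G` is uniquely `n * k` with `n ∈ N`, `k ∈ K`). -/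
def HasComplement {G : Type u} [Group G] (N : Subgroup G) : Prop :=
  ∃ K : Subgroup G, N.IsComplement' K

/-- The inner automorphism group `Inn(N)`, as a subgroup of `Aut(N)`. -/
def Inn (N : Type u) [Group N] : Subgroup (MulAut N) :=
  (MulAut.conj : N →* MulAut N).range

instance Inn.normal (N : Type u) [Group N] : (Inn N).Normal := by
  refine ⟨?_⟩
  rintro _ ⟨x, rfl⟩ a
  refine ⟨a x, ?_⟩
  ext y
  simp [MulAut.conj_apply]

/-- The outer automorphism group `Out(N) = Aut(N) / Inn(N)`. -/
abbrev Out (N : Type u) [Group N] : Type u := MulAut N ⧸ Inn N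

/-- Rose's criterion for `N`: `Z(N) = 1` and `Inn(N)` has a complement in `Aut(N)`. -/
def RoseCriterion (N : Type u) [Group N] : Prop :=
  Subgroup.center N = ⊥ ∧ HasComplement (Inn N)

/-- Gaschütz' theorem holds for `N`: whenever `N` is embedded (through `f`) as a normal subgroup
of a finite group `G`, and `N ≤ H ≤ G` is such that `gcd(|N|, |G : H|) = 1` and `N` has a
complement in `H`, then `N` has a complement in `G`.
(As `G` is finite, its universe level is immaterial.) -/
def GaschuetzHolds (N : Type u) [Group N] : Prop :=
  ∀ (G : Type u) [Group G] [Finite G] (f : N →* G), Function.Injective f → f.range.Normal →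
    ∀ H : Subgroup G, f.range ≤ H → (Nat.card N).Coprime H.index →
      HasComplement (f.range.subgroupOf H) → HasComplement f.range

/-- `G` is the internal direct product of the family `N` of subgroups: all `N i` are normal,
together they generate `G`, and each `N i` intersects the subgroup generated by the others
trivially. -/
def IsInternalDirectProduct {G : Type u} [Group G] {ι : Type v} (N : ι → Subgroup G) : Prop :=
  (∀ i, (N i).Normal) ∧ (⨆ i, N i) = ⊤ ∧ ∀ i, N i ⊓ (⨆ j, ⨆ _ : j ≠ i, N j) = ⊥

/-- All Sylow subgroups of `G` (for all primes) are abelian. -/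
def AllSylowAbelian (G : Type u) [Group G] : Prop :=
  ∀ p : ℕ, p.Prime → ∀ P : Sylow p G, ∀ x ∈ P, ∀ y ∈ P, x * y = y * x

/-! ### Complements of normal subgroups -/

/-! Complements of N in G are found in two stages. If M ≤ N are normal in G and L/M complements N/M
in G/M, then L ∩ N = M and NL = G, so every complement of M in L also complements N in G
(`hasComplement_of_supplement`). Gaschütz' theorem for N/M supplies L; what remains is to complement
M in L.

For a product of characteristic subgroups, M is the product of all factors but one, and an induction
continues inside L. If M satisfies Rose's criterion, the conjugation action L → Aut(M) pulls a
complement of Inn(M) back to a complement of M.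

In the coprime case let m = |M|, C = C_G(N) and D = [C, C]. A wreath product construction
(`GaschuetzHolds.exists_complement_commutator_le`) shows that L may be chosen to contain D. By
Schur–Zassenhaus it can then be made to contain Y, the group of elements of C having m-power order
modulo D. Coprimality to |Z(N)| gives N ∩ Y = 1, and coprimality to |Out(N)| makes |G : NY| prime to
m. Now MY/Y has exponent dividing m and index prime to m in L/Y, so Schur–Zassenhaus in L/Y yields
the complement of M.

For Rose's criterion of a product, the point is that in a centreless group the intersection of two
direct factors is again a direct factor. Hence the minimal direct factors commute pairwise, generate
the group and are permuted by all automorphisms. Choosing complements coherently for all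
isomorphisms between them (`exists_groupoid_complement`) gives a complement of Inn(N). Conversely, a
complement for A × B projects to one for A. -/

lemma hasComplement_iff_of_normal {G : Type u} [Group G] (N : Subgroup G) [N.Normal] :
    HasComplement N ↔ ∃ K : Subgroup G, N ⊓ K = ⊥ ∧ N ⊔ K = ⊤ := by
  constructor
  · rintro ⟨K, hK⟩
    exact ⟨K, hK.disjoint.eq_bot, hK.sup_eq_top⟩
  · rintro ⟨K, h1, h2⟩
    refine ⟨K, Subgroup.isComplement'_of_disjoint_and_mul_eq_univ (disjoint_iff.2 h1) ?_⟩
    rw [← Subgroup.normal_mul, h2, Subgroup.coe_top]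

lemma hasComplement_subgroupOf_iff {G : Type u} [Group G] {N H : Subgroup G} [N.Normal]
    (hNH : N ≤ H) :
    HasComplement (N.subgroupOf H) ↔ ∃ K : Subgroup G, N ⊓ K = ⊥ ∧ N ⊔ K = H := by
  rw [hasComplement_iff_of_normal]
  constructor
  · rintro ⟨K, h1, h2⟩
    refine ⟨K.map H.subtype, ?_, ?_⟩
    · rw [← Subgroup.map_subgroupOf_eq_of_le hNH,
        ← Subgroup.map_inf _ _ _ H.subtype_injective, h1, Subgroup.map_bot]
    · rw [← Subgroup.map_subgroupOf_eq_of_le hNH, ← Subgroup.map_sup, h2,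
        ← MonoidHom.range_eq_map, Subgroup.range_subtype]
  · rintro ⟨K, h1, h2⟩
    have hK : K ≤ H := h2 ▸ le_sup_right
    refine ⟨K.subgroupOf H, ?_, ?_⟩
    · refine (Subgroup.comap_inf N K H.subtype).symm.trans ?_
      rw [h1]
      exact Subgroup.bot_subgroupOf H
    · rw [← Subgroup.subgroupOf_sup hNH hK, h2, Subgroup.subgroupOf_self]

/-- Q ∩ N lies in L ∩ N ≤ M, hence in M ∩ Q = 1, and NQ = NMQ = NL = G. -/
lemma hasComplement_of_supplement {G : Type u} [Group G] {N M L Q : Subgroup G} [N.Normal]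
    (hMN : M ≤ N) (h1 : L ⊓ N ≤ M) (h2 : N ⊔ L = ⊤) (h3 : M ⊓ Q = ⊥) (h4 : M ⊔ Q = L) :
    HasComplement N := by
  refine (hasComplement_iff_of_normal N).2 ⟨Q, ?_, ?_⟩
  · refine le_bot_iff.1 (h3 ▸ le_inf (le_trans (le_inf ?_ inf_le_left) h1) inf_le_right)
    exact inf_le_right.trans (h4 ▸ le_sup_right)
  · refine top_le_iff.1 (h2 ▸ sup_le le_sup_left (h4 ▸ sup_le (hMN.trans le_sup_left) le_sup_right))

lemma exists_mul_of_sup_eq {G : Type u} [Group G] {N K H : Subgroup G} [N.Normal]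
    (h : N ⊔ K = H) {g : G} (hg : g ∈ H) : ∃ n ∈ N, ∃ k ∈ K, n * k = g :=
  Subgroup.mem_sup_of_normal_left.1 (h ▸ hg)

lemma eq_one_of_mem_of_inf_eq_bot {G : Type u} [Group G] {N K : Subgroup G}
    (h : N ⊓ K = ⊥) {g : G} (h1 : g ∈ N) (h2 : g ∈ K) : g = 1 :=
  Subgroup.mem_bot.1 (h ▸ Subgroup.mem_inf.2 ⟨h1, h2⟩)

/-! ### Using Gaschütz' theorem -/

lemma GaschuetzHolds.of_mulEquiv {A B : Type u} [Group A] [Group B] (e : A ≃* B)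
    (h : GaschuetzHolds A) : GaschuetzHolds B := by
  intro G _ _ f hf hn H hH hc hcomp
  have hr : (f.comp e.toMonoidHom).range = f.range := by
    rw [MonoidHom.range_comp, MonoidHom.range_eq_top.2 e.surjective, ← MonoidHom.range_eq_map]
  have := h G (f.comp e.toMonoidHom) (hf.comp e.injective) (hr ▸ hn) H (hr ▸ hH)
    (Nat.card_congr e.toEquiv ▸ hc)
  rw [hr] at this
  exact this hcomp

lemma GaschuetzHolds.exists_complement {G : Type u} [Group G] [Finite G] {N : Subgroup G}
    [N.Normal] (h : GaschuetzHolds N) {H J : Subgroup G} (hc : (Nat.card N).Coprime H.index)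
    (h1 : N ⊓ J = ⊥) (h2 : N ⊔ J = H) : ∃ K : Subgroup G, N ⊓ K = ⊥ ∧ N ⊔ K = ⊤ := by
  have hNH : N ≤ H := h2 ▸ le_sup_left
  have := h G N.subtype N.subtype_injective
  rw [Subgroup.range_subtype] at this
  exact (hasComplement_iff_of_normal N).1
    (this ‹_› H hNH hc ((hasComplement_subgroupOf_iff hNH).2 ⟨J, h1, h2⟩))

lemma gaschuetzHolds_of_forall {N : Type u} [Group N]
    (h : ∀ (G : Type u) [Group G] [Finite G] (f : N →* G) (_ : Function.Injective f)
      (_ : f.range.Normal) (H J : Subgroup G) (_ : (Nat.card f.range).Coprime H.index)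
      (_ : f.range ⊓ J = ⊥) (_ : f.range ⊔ J = H), HasComplement f.range) :
    GaschuetzHolds N := by
  intro G _ _ f hf hn H hH hc hcomp
  obtain ⟨J, h1, h2⟩ := (hasComplement_subgroupOf_iff hH).1 hcomp
  exact h G f hf hn H J (Nat.card_congr (MonoidHom.ofInjective hf).toEquiv ▸ hc) h1 h2

/-- A complement modulo a normal subgroup `M` pulls back to a supplement meeting `N` in `M`. -/
lemma comap_mk_complement {G : Type u} [Group G] {M N : Subgroup G} [M.Normal] [N.Normal]
    (hMN : M ≤ N) {K : Subgroup (G ⧸ M)} (h1 : N.map (QuotientGroup.mk' M) ⊓ K = ⊥)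
    (h2 : N.map (QuotientGroup.mk' M) ⊔ K = ⊤) :
    M ≤ K.comap (QuotientGroup.mk' M) ∧ K.comap (QuotientGroup.mk' M) ⊓ N ≤ M ∧
      N ⊔ K.comap (QuotientGroup.mk' M) = ⊤ := by
  have hs := QuotientGroup.mk'_surjective M
  have hM : M ≤ K.comap (QuotientGroup.mk' M) := by
    intro x hx
    rw [Subgroup.mem_comap, QuotientGroup.mk'_apply, (QuotientGroup.eq_one_iff x).2 hx]
    exact K.one_mem
  refine ⟨hM, ?_, ?_⟩
  · rintro x ⟨hx, hxN⟩
    have := eq_one_of_mem_of_inf_eq_bot h1 (Subgroup.mem_map_of_mem _ hxN) hx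
    exact (QuotientGroup.eq_one_iff x).1 this
  · have : (N ⊔ K.comap (QuotientGroup.mk' M)).map (QuotientGroup.mk' M) = ⊤ := by
      rw [Subgroup.map_sup, Subgroup.map_comap_eq_self_of_surjective hs, h2]
    rw [← top_le_iff, ← Subgroup.comap_top (QuotientGroup.mk' M), ← this, Subgroup.comap_map_eq,
      QuotientGroup.ker_mk']
    exact sup_le le_rfl (hMN.trans le_sup_left)

lemma exists_complement_map_mk {G : Type u} [Group G] [Finite G] {M N : Subgroup G} [M.Normal]
    [N.Normal] (hMN : M ≤ N) (h : GaschuetzHolds (N.map (QuotientGroup.mk' M))) {H J : Subgroup G}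
    (hc : (Nat.card N).Coprime H.index) (h1 : N ⊓ J = ⊥) (h2 : N ⊔ J = H) :
    ∃ K : Subgroup (G ⧸ M), N.map (QuotientGroup.mk' M) ⊓ K = ⊥ ∧
      N.map (QuotientGroup.mk' M) ⊔ K = ⊤ := by
  have : (N.map (QuotientGroup.mk' M)).Normal :=
    Subgroup.Normal.map ‹_› _ (QuotientGroup.mk'_surjective M)
  have hNH : N ≤ H := h2 ▸ le_sup_left
  refine h.exists_complement (H := H.map (QuotientGroup.mk' M))
    (J := J.map (QuotientGroup.mk' M)) ?_ ?_ ?_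
  · refine Nat.Coprime.coprime_dvd_left (Subgroup.card_map_dvd N _) ?_
    exact hc.coprime_dvd_right (Subgroup.index_map_dvd H (QuotientGroup.mk'_surjective M))
  -- If n and j agree modulo M ≤ N, then j lies in N ∩ J = 1.
  · rw [eq_bot_iff]
    rintro _ ⟨⟨n, hn, rfl⟩, ⟨j, hj, hjn⟩⟩
    have hm : n⁻¹ * j ∈ M := by
      rw [← QuotientGroup.eq]
      exact hjn.symm
    have hjN : j ∈ N := by
      have := N.mul_mem hn (hMN hm)
      rwa [mul_inv_cancel_left] at this
    have : j = 1 := eq_one_of_mem_of_inf_eq_bot h1 hjN hj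
    rw [Subgroup.mem_bot, ← hjn, this, map_one]
  · rw [← Subgroup.map_sup, h2]

lemma exists_supplement {G : Type u} [Group G] [Finite G] {M N : Subgroup G} [M.Normal]
    [N.Normal] (hMN : M ≤ N) (h : GaschuetzHolds (N.map (QuotientGroup.mk' M))) {H J : Subgroup G}
    (hc : (Nat.card N).Coprime H.index) (h1 : N ⊓ J = ⊥) (h2 : N ⊔ J = H) :
    ∃ L : Subgroup G, M ≤ L ∧ L ⊓ N ≤ M ∧ N ⊔ L = ⊤ := by
  obtain ⟨K, hK1, hK2⟩ := exists_complement_map_mk hMN h hc h1 h2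
  exact ⟨_, comap_mk_complement hMN hK1 hK2⟩

/-- A characteristic subgroup of an embedded normal subgroup is normal. -/
lemma normal_map_of_characteristic {N G : Type u} [Group N] [Group G] {f : N →* G}
    (hf : Function.Injective f) (hn : f.range.Normal) (M : Subgroup N) [M.Characteristic] :
    (M.map f).Normal := by
  let e := MonoidHom.ofInjective hf
  refine ⟨?_⟩
  rintro _ ⟨x, hx, rfl⟩ g
  let α : MulAut N := (e.trans (MulAut.conjNormal g)).trans e.symm
  refine ⟨α x, ?_, ?_⟩
  · have := Subgroup.characteristic_iff_map_eq.1 ‹M.Characteristic› α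
    exact this ▸ Subgroup.mem_map_of_mem _ hx
  · have : e (α x) = MulAut.conjNormal g (e x) := by simp [α]
    have h2 := congrArg Subtype.val this
    rw [MulAut.conjNormal_apply] at h2
    exact h2

/-- The image of `N` in `G / f(M)` is `N / M`. -/
noncomputable def quotientEquivMapMk {N G : Type u} [Group N] [Group G] {f : N →* G}
    (hf : Function.Injective f) (M : Subgroup N) [M.Normal] [(M.map f).Normal] :
    N ⧸ M ≃* f.range.map (QuotientGroup.mk' (M.map f)) :=
  have hk : M = ((QuotientGroup.mk' (M.map f)).comp f).ker := by
    rw [← MonoidHom.comap_ker, QuotientGroup.ker_mk', Subgroup.comap_map_eq_self_of_injective hf]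
  have hr : ((QuotientGroup.mk' (M.map f)).comp f).range =
      f.range.map (QuotientGroup.mk' (M.map f)) := MonoidHom.range_comp _ _
  (QuotientGroup.quotientMulEquivOfEq hk).trans
    ((QuotientGroup.quotientKerEquivRange _).trans (MulEquiv.subgroupCongr hr))

/-! ### Rose's criterion -/

/-- The first condition on `S` merges Z(N) = 1 with Inn(N) ∩ S = 1, so that later arguments need
only elements of N. -/
lemma roseCriterion_iff (N : Type u) [Group N] :
    RoseCriterion N ↔ ∃ S : Subgroup (MulAut N),
      (∀ n : N, MulAut.conj n ∈ S → n = 1) ∧ ∀ α : MulAut N, ∃ n : N, MulAut.conj n * α ∈ S := by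
  have hconj : ∀ n : N, MulAut.conj n = 1 ↔ n ∈ Subgroup.center N := by
    intro n
    rw [Subgroup.mem_center_iff, MulEquiv.ext_iff]
    refine forall_congr' fun g => ?_
    rw [MulAut.conj_apply, MulAut.one_apply, mul_inv_eq_iff_eq_mul, eq_comm]
  rw [RoseCriterion, hasComplement_iff_of_normal]
  constructor
  · rintro ⟨hZ, S, h1, h2⟩
    refine ⟨S, fun n hn => ?_, fun α => ?_⟩
    · have := (hconj n).1 (eq_one_of_mem_of_inf_eq_bot h1 ⟨n, rfl⟩ hn)
      rwa [hZ, Subgroup.mem_bot] at this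
    · obtain ⟨_, ⟨n, rfl⟩, s, hs, rfl⟩ := exists_mul_of_sup_eq h2 (Subgroup.mem_top α)
      refine ⟨n⁻¹, ?_⟩
      rwa [map_inv, inv_mul_cancel_left]
  · rintro ⟨S, h1, h2⟩
    refine ⟨?_, S, ?_, ?_⟩
    · rw [eq_bot_iff]
      intro n hn
      exact h1 n ((hconj n).2 hn ▸ S.one_mem)
    · rw [eq_bot_iff]
      rintro _ ⟨⟨n, rfl⟩, hn⟩
      rw [Subgroup.mem_bot, h1 n hn, map_one]
    · rw [eq_top_iff]
      intro α _
      obtain ⟨n, hn⟩ := h2 α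
      rw [← inv_mul_cancel_left (MulAut.conj n) α, ← map_inv]
      exact Subgroup.mul_mem_sup ⟨n⁻¹, rfl⟩ hn

lemma RoseCriterion.of_mulEquiv {A B : Type u} [Group A] [Group B] (e : A ≃* B)
    (h : RoseCriterion A) : RoseCriterion B := by
  rw [roseCriterion_iff] at h ⊢
  obtain ⟨S, h1, h2⟩ := h
  have key : ∀ b : B, (MulAut.congr e).symm (MulAut.conj b) = MulAut.conj (e.symm b) := by
    intro b
    ext x
    simp [MulAut.congr]
  refine ⟨S.comap (MulAut.congr e).symm.toMonoidHom, fun b hb => ?_, fun β => ?_⟩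
  · have := h1 (e.symm b) (key b ▸ hb)
    simpa using this
  · obtain ⟨a, ha⟩ := h2 ((MulAut.congr e).symm β)
    refine ⟨e a, ?_⟩
    change (MulAut.congr e).symm (MulAut.conj (e a) * β) ∈ S
    rwa [map_mul, key, e.symm_apply_apply]

/-- The complement for A consists of those α for which α × conj b lies in `S` for some b. The free
inner part on B absorbs the second coordinate of the correction (a, b) that moves α × 1 into `S`. -/
lemma RoseCriterion.fst_of_prod {A B : Type u} [Group A] [Group B]
    (h : RoseCriterion (A × B)) : RoseCriterion A := by
  rw [roseCriterion_iff] at h ⊢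
  obtain ⟨S, h1, h2⟩ := h
  let p : MulAut A → B → MulAut (A × B) := fun α b => α.prodCongr (MulAut.conj b)
  have p_conj : ∀ a b, p (MulAut.conj a) b = MulAut.conj (a, b) := fun a b => rfl
  have p_mul : ∀ α β b c, p α b * p β c = p (α * β) (b * c) := by
    intro α β b c
    refine MulEquiv.ext fun x => Prod.ext rfl ?_
    change MulAut.conj b (MulAut.conj c x.2) = MulAut.conj (b * c) x.2
    rw [map_mul, MulAut.mul_apply]
  have p_one : p 1 1 = 1 := by
    refine MulEquiv.ext fun x => Prod.ext rfl ?_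
    change MulAut.conj 1 x.2 = x.2
    rw [map_one, MulAut.one_apply]
  have p_inv : ∀ α b, (p α b)⁻¹ = p α⁻¹ b⁻¹ := by
    intro α b
    rw [inv_eq_iff_mul_eq_one, p_mul, mul_inv_cancel, mul_inv_cancel, p_one]
  let T : Subgroup (MulAut A) :=
    { carrier := {α | ∃ b, p α b ∈ S}
      one_mem' := ⟨1, p_one ▸ S.one_mem⟩
      mul_mem' := by
        rintro α β ⟨b, hb⟩ ⟨c, hc⟩
        exact ⟨b * c, p_mul α β b c ▸ S.mul_mem hb hc⟩
      inv_mem' := by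
        rintro α ⟨b, hb⟩
        exact ⟨b⁻¹, p_inv α b ▸ S.inv_mem hb⟩ }
  refine ⟨T, ?_, fun α => ?_⟩
  · rintro a ⟨b, hb⟩
    exact (Prod.ext_iff.1 (h1 (a, b) (p_conj a b ▸ hb))).1
  · obtain ⟨⟨a, b⟩, hab⟩ := h2 (p α 1)
    refine ⟨a, b, ?_⟩
    rwa [← p_conj, p_mul, mul_one] at hab

/-- A normal subgroup satisfying Rose's criterion is complemented. -/
lemma RoseCriterion.hasComplement {G : Type u} [Group G] {M : Subgroup G} [M.Normal]
    (h : RoseCriterion M) : HasComplement M := by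
  obtain ⟨S, h1, h2⟩ := (roseCriterion_iff M).1 h
  have key : ∀ m : M, MulAut.conjNormal (m : G) = MulAut.conj m := by
    intro m
    ext x
    simp
  refine (hasComplement_iff_of_normal M).2 ⟨S.comap MulAut.conjNormal, ?_, ?_⟩
  · rw [eq_bot_iff]
    rintro m ⟨hm, hS⟩
    have := h1 ⟨m, hm⟩ (key ⟨m, hm⟩ ▸ hS)
    exact congrArg Subtype.val this
  · rw [eq_top_iff]
    intro g _
    obtain ⟨m, hm⟩ := h2 (MulAut.conjNormal g)
    rw [← inv_mul_cancel_left (m : G) g]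
    refine Subgroup.mul_mem_sup (M.inv_mem m.2) ?_
    rwa [Subgroup.mem_comap, map_mul, key]

/-- In a family of groups satisfying Rose's criterion, the inner automorphisms are complemented
in the groupoid of all isomorphisms between members of the family. -/
lemma exists_groupoid_complement {ι : Type v} (N : ι → Type u) [∀ i, Group (N i)]
    (h : ∀ i, RoseCriterion (N i)) :
    ∃ C : ∀ i j, Set (N i ≃* N j), (∀ i, MulEquiv.refl (N i) ∈ C i i) ∧
      (∀ i j k, ∀ e ∈ C i j, ∀ e' ∈ C j k, e.trans e' ∈ C i k) ∧
      (∀ i j, ∀ e ∈ C i j, e.symm ∈ C j i) ∧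
      (∀ i (x : N i), MulAut.conj x ∈ C i i → x = 1) ∧
      ∀ i j (e : N i ≃* N j), ∃ x : N j, e.trans (MulAut.conj x) ∈ C i j := by
  choose S hS1 hS2 using fun i => (roseCriterion_iff (N i)).1 (h i)
  let s : Setoid ι :=
    { r := fun i j => Nonempty (N i ≃* N j)
      iseqv := ⟨fun i => ⟨MulEquiv.refl _⟩, fun ⟨e⟩ => ⟨e.symm⟩, fun ⟨e⟩ ⟨f⟩ => ⟨e.trans f⟩⟩ }
  let rep : ι → ι := fun i => (Quotient.mk s i).out
  have hrep : ∀ t i, rep i = t → Nonempty (N t ≃* N i) := by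
    rintro t i rfl
    exact Quotient.mk_out (s := s) i
  -- One reference isomorphism from the representative of each class to every member; conjugating by
  -- these compares any isomorphism with the complement at the representative. The representative is
  -- a variable with an equation, so that equal ones can be substituted.
  obtain ⟨φ⟩ : Nonempty (∀ t i, rep i = t → (N t ≃* N i)) :=
    ⟨fun t i hi => (hrep t i hi).some⟩
  refine ⟨fun i j => {e | ∃ (t : ι) (hi : rep i = t) (hj : rep j = t),
    (φ t i hi).trans (e.trans (φ t j hj).symm) ∈ S t}, ?_, ?_, ?_, ?_, ?_⟩
  · intro i
    refine ⟨rep i, rfl, rfl, ?_⟩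
    convert (S (rep i)).one_mem
    ext x
    simp
  · rintro i j k e ⟨t, hi, hj, he⟩ e' ⟨t', hj', hk, he'⟩
    obtain rfl : t = t' := hj.symm.trans hj'
    refine ⟨t, hi, hk, ?_⟩
    convert (S t).mul_mem he' he
    ext x
    simp
  · rintro i j e ⟨t, hi, hj, he⟩
    refine ⟨t, hj, hi, ?_⟩
    convert (S t).inv_mem he
    rfl
  · rintro i x ⟨t, hi, hi', hx⟩
    have := hS1 t ((φ t i hi).symm x) (by
      convert hx
      ext y
      simp)
    simpa using this
  · intro i j e
    have hij : rep i = rep j := congrArg Quotient.out (Quotient.sound (s := s) ⟨e⟩)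
    obtain ⟨y, hy⟩ := hS2 (rep j) ((φ (rep j) i hij).trans (e.trans (φ (rep j) j rfl).symm))
    refine ⟨φ (rep j) j rfl y, rep j, hij, rfl, ?_⟩
    convert hy
    ext x
    simp

/-! ### Direct factors of groups with trivial centre -/

/-- `D` is a direct factor: `N = D * C_N(D)`. -/
def IsDirectFactor {N : Type u} [Group N] (D : Subgroup N) : Prop :=
  ∀ n : N, ∃ a ∈ D, ∃ c ∈ Subgroup.centralizer (D : Set N), a * c = n

section DirectFactor

variable {N : Type u} [Group N] {D E : Subgroup N}

lemma mem_center_of_mem_centralizer (hD : IsDirectFactor D) {x : N}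
    (h1 : ∀ d ∈ D, d * x = x * d) (h2 : ∀ c ∈ Subgroup.centralizer (D : Set N), c * x = x * c) :
    x ∈ Subgroup.center N := by
  rw [Subgroup.mem_center_iff]
  intro n
  obtain ⟨a, ha, c, hc, rfl⟩ := hD n
  rw [mul_assoc, h2 c hc, ← mul_assoc, h1 a ha, mul_assoc]

lemma IsDirectFactor.eq_one (hD : IsDirectFactor D) (hZ : Subgroup.center N = ⊥) {x : N}
    (h1 : x ∈ D) (h2 : x ∈ Subgroup.centralizer (D : Set N)) : x = 1 := by
  have := mem_center_of_mem_centralizer hD (fun d hd => Subgroup.mem_centralizer_iff.1 h2 d hd)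
    (fun c hc => (Subgroup.mem_centralizer_iff.1 hc x h1).symm)
  rwa [hZ, Subgroup.mem_bot] at this

lemma IsDirectFactor.normal (hD : IsDirectFactor D) : D.Normal := by
  refine ⟨fun d hd n => ?_⟩
  obtain ⟨a, ha, c, hc, rfl⟩ := hD n
  have : a * c * d * (a * c)⁻¹ = a * d * a⁻¹ := by
    rw [mul_assoc a c d, ← Subgroup.mem_centralizer_iff.1 hc d hd]
    group
  rw [this]
  exact D.mul_mem (D.mul_mem ha hd) (D.inv_mem ha)

/-- This is the double centralizer property: the component of b in C_N(D) commutes with both D and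
C_N(D), so it is central and trivial. -/
lemma IsDirectFactor.mem_of_commute (hD : IsDirectFactor D) (hZ : Subgroup.center N = ⊥) {b : N}
    (hb : ∀ c ∈ Subgroup.centralizer (D : Set N), c * b = b * c) : b ∈ D := by
  obtain ⟨d, hd, f, hf, rfl⟩ := hD b
  have : f ∈ Subgroup.center N := by
    refine mem_center_of_mem_centralizer hD (fun x hx => Subgroup.mem_centralizer_iff.1 hf x hx) ?_
    intro c hc
    have h1 := hb c hc
    rw [← mul_assoc, ← Subgroup.mem_centralizer_iff.1 hc d hd, mul_assoc, mul_assoc] at h1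
    exact mul_left_cancel h1
  rw [hZ, Subgroup.mem_bot] at this
  rwa [this, mul_one]

lemma IsDirectFactor.centralizer (hD : IsDirectFactor D) :
    IsDirectFactor (Subgroup.centralizer (D : Set N)) := by
  intro n
  obtain ⟨a, ha, c, hc, rfl⟩ := hD n
  refine ⟨c, hc, a, ?_, (Subgroup.mem_centralizer_iff.1 hc a ha).symm⟩
  rw [Subgroup.mem_centralizer_iff]
  intro x hx
  exact (Subgroup.mem_centralizer_iff.1 hx a ha).symm

/-- Components of elements of a direct factor with respect to another one stay in it. -/
lemma IsDirectFactor.left_mem (hD : IsDirectFactor D) (hE : IsDirectFactor E)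
    (hZ : Subgroup.center N = ⊥) {b c : N} (hb : b ∈ E)
    (hc : c ∈ Subgroup.centralizer (E : Set N)) (h : b * c ∈ D) : b ∈ D := by
  refine hD.mem_of_commute hZ fun x hx => ?_
  obtain ⟨b', hb', c', hc', rfl⟩ := hE x
  have hx' := Subgroup.mem_centralizer_iff.1 hx _ h
  have e1 : ∀ y ∈ E, y * c = c * y := Subgroup.mem_centralizer_iff.1 hc
  have e2 : ∀ y ∈ E, y * c' = c' * y := Subgroup.mem_centralizer_iff.1 hc'
  have hx2 : (b * b') * (c * c') = (b' * b) * (c' * c) := by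
    calc (b * b') * (c * c') = b * (b' * c) * c' := by group
      _ = (b * c) * (b' * c') := by rw [e1 b' hb']; group
      _ = (b' * c') * (b * c) := hx'
      _ = b' * (c' * b) * c := by group
      _ = (b' * b) * (c' * c) := by rw [← e2 b hb]; group
  -- The left side lies in E and the right side in its centralizer, so both are trivial; thus b
  -- commutes with b', and therefore with x.
  have h3 : (b' * b)⁻¹ * (b * b') = (c' * c) * (c * c')⁻¹ := by
    rw [inv_mul_eq_iff_eq_mul, ← mul_assoc, eq_mul_inv_iff_mul_eq, hx2]
  have h4 : (b' * b)⁻¹ * (b * b') = 1 := by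
    refine hE.eq_one hZ (E.mul_mem (E.inv_mem (E.mul_mem hb' hb)) (E.mul_mem hb hb')) ?_
    rw [h3]
    exact Subgroup.mul_mem _ (Subgroup.mul_mem _ hc' hc)
      (Subgroup.inv_mem _ (Subgroup.mul_mem _ hc hc'))
  rw [inv_mul_eq_one] at h4
  rw [mul_assoc, ← e2 b hb, ← mul_assoc, h4, mul_assoc]

lemma IsDirectFactor.inf (hD : IsDirectFactor D) (hE : IsDirectFactor E)
    (hZ : Subgroup.center N = ⊥) : IsDirectFactor (D ⊓ E) := by
  intro n
  obtain ⟨a, ha, c, hc, rfl⟩ := hD n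
  obtain ⟨b, hb, d, hd, rfl⟩ := hE a
  refine ⟨b, ⟨hD.left_mem hE hZ hb hd ha, hb⟩, d * c, Subgroup.mul_mem _ ?_ ?_, by group⟩
  · rw [Subgroup.mem_centralizer_iff] at hd ⊢
    exact fun x hx => hd x hx.2
  · rw [Subgroup.mem_centralizer_iff] at hc ⊢
    exact fun x hx => hc x hx.1

/-- By `left_mem` the E-component of an element of D stays in D ∩ E = 1, leaving only its component
in the centralizer of E. -/
lemma IsDirectFactor.commute_of_inf_eq_bot (hD : IsDirectFactor D) (hE : IsDirectFactor E)
    (hZ : Subgroup.center N = ⊥) (h : D ⊓ E = ⊥) :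
    D ≤ Subgroup.centralizer (E : Set N) := by
  intro a ha
  obtain ⟨b, hb, d, hd, rfl⟩ := hE a
  have : b = 1 := eq_one_of_mem_of_inf_eq_bot h (hD.left_mem hE hZ hb hd ha) hb
  rwa [this, one_mul]

lemma IsDirectFactor.map (hD : IsDirectFactor D) {M : Type u} [Group M] (α : N ≃* M) :
    IsDirectFactor (D.map α.toMonoidHom) := by
  intro n
  obtain ⟨a, ha, c, hc, h⟩ := hD (α.symm n)
  refine ⟨α a, ⟨a, ha, rfl⟩, α c, ?_, ?_⟩
  · rw [Subgroup.mem_centralizer_iff] at hc ⊢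
    rintro _ ⟨x, hx, rfl⟩
    change α x * α c = α c * α x
    rw [← map_mul, hc x hx, map_mul]
  · rw [← map_mul, h, α.apply_symm_apply]

lemma IsDirectFactor.subgroupOf (hD : IsDirectFactor D) (hDE : D ≤ E) :
    IsDirectFactor (D.subgroupOf E) := by
  rintro ⟨n, hn⟩
  obtain ⟨a, ha, c, hc, h⟩ := hD n
  have hcE : c ∈ E := by
    rw [← E.mul_mem_cancel_left (hDE ha), h]
    exact hn
  refine ⟨⟨a, hDE ha⟩, ha, ⟨c, hcE⟩, ?_, Subtype.ext h⟩
  rw [Subgroup.mem_centralizer_iff] at hc ⊢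
  exact fun x hx => Subtype.ext (hc x hx)

/-- A direct factor of a group satisfying Rose's criterion satisfies Rose's criterion. -/
lemma RoseCriterion.of_isDirectFactor (h : RoseCriterion N) (hD : IsDirectFactor D) :
    RoseCriterion D := by
  let f : D × Subgroup.centralizer (D : Set N) →* N :=
    MonoidHom.noncommCoprod D.subtype (Subgroup.centralizer (D : Set N)).subtype
      fun d c => Subgroup.mem_centralizer_iff.1 c.2 d d.2
  have hf : Function.Bijective f := by
    constructor
    · rw [injective_iff_map_eq_one]
      rintro ⟨⟨d, hd⟩, ⟨c, hc⟩⟩ h1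
      have h1 : d * c = 1 := h1
      have hd1 : d = 1 := by
        refine hD.eq_one h.1 hd ?_
        rw [eq_inv_of_mul_eq_one_left h1]
        exact Subgroup.inv_mem _ hc
      subst hd1
      rw [one_mul] at h1
      subst h1
      rfl
    · intro n
      obtain ⟨a, ha, c, hc, rfl⟩ := hD n
      exact ⟨(⟨a, ha⟩, ⟨c, hc⟩), rfl⟩
  exact (h.of_mulEquiv (MulEquiv.ofBijective f hf).symm).fst_of_prod

end DirectFactor

/-- If a centreless group is generated by pairwise commuting direct factors that satisfy Rose's
criterion and are permuted by all automorphisms, then it satisfies Rose's criterion. -/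
lemma roseCriterion_of_permuted_factors {N : Type u} [Group N] [Finite N]
    (𝒜 : Set (Subgroup N)) (hmap : ∀ α : MulAut N, ∀ A ∈ 𝒜, A.map α.toMonoidHom ∈ 𝒜)
    (hfac : ∀ A ∈ 𝒜, IsDirectFactor A)
    (hcomm : ∀ A ∈ 𝒜, ∀ B ∈ 𝒜, A ≠ B → A ≤ Subgroup.centralizer (B : Set N))
    (hgen : ∀ x : N, (∀ A ∈ 𝒜, x ∈ Subgroup.centralizer (A : Set N)) → x = 1)
    (hrose : ∀ A ∈ 𝒜, RoseCriterion A) : RoseCriterion N := by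
  obtain ⟨C, C_refl, C_trans, C_symm, C_conj, C_ex⟩ :=
    exists_groupoid_complement (fun A : 𝒜 => (A : Subgroup N)) fun A => hrose A A.2
  -- An automorphism belongs to `S` when each of its restrictions A ≃ B between members of the
  -- family belongs to the groupoid complement.
  let S : Subgroup (MulAut N) :=
    { carrier := {α | ∀ (A B : 𝒜) (e : (A : Subgroup N) ≃* (B : Subgroup N)),
        (∀ x, (e x : N) = α x) → e ∈ C A B}
      one_mem' := by
        intro A B e he
        have hAB : A = B := by
          refine Subtype.ext (Subgroup.ext fun x => ⟨fun hx => ?_, fun hx => ?_⟩)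
          · have := he ⟨x, hx⟩
            rw [MulAut.one_apply] at this
            exact (show _ = x from this) ▸ (e ⟨x, hx⟩).2
          · have := he (e.symm ⟨x, hx⟩)
            rw [MulAut.one_apply, e.apply_symm_apply] at this
            exact (show x = _ from this) ▸ (e.symm ⟨x, hx⟩).2
        subst hAB
        have : e = MulEquiv.refl _ := MulEquiv.ext fun x => Subtype.ext (he x)
        exact this ▸ C_refl A
      mul_mem' := by
        intro α β hα hβ A B e he
        let A' : 𝒜 := ⟨_, hmap β A A.2⟩
        let e₁ : (A : Subgroup N) ≃* (A' : Subgroup N) := β.subgroupMap A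
        have h1 : e₁ ∈ C A A' := hβ A A' e₁ fun x => rfl
        have h2 : e₁.symm.trans e ∈ C A' B := by
          refine hα A' B _ fun y => ?_
          obtain ⟨x, rfl⟩ := e₁.surjective y
          rw [MulEquiv.trans_apply, e₁.symm_apply_apply, he x]
          rfl
        have := C_trans _ _ _ _ h1 _ h2
        convert this
        ext x
        simp
      inv_mem' := by
        intro α hα A B e he
        refine C_symm B A e.symm (hα B A e.symm fun y => ?_)
        obtain ⟨x, rfl⟩ := e.surjective y
        rw [e.symm_apply_apply, he x]
        exact (α.apply_symm_apply x).symm }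
  refine (roseCriterion_iff N).2 ⟨S, fun n hn => hgen n fun A hA => ?_, fun α => ?_⟩
  · obtain ⟨a, ha, c, hc, rfl⟩ := hfac A hA n
    have : (⟨a, ha⟩ : A) = 1 := by
      refine C_conj ⟨A, hA⟩ ⟨a, ha⟩ (hn ⟨A, hA⟩ ⟨A, hA⟩ (MulAut.conj ⟨a, ha⟩) fun x => ?_)
      change a * x * a⁻¹ = a * c * x * (a * c)⁻¹
      have hx := Subgroup.mem_centralizer_iff.1 hc x x.2
      rw [mul_assoc a c, ← hx]
      group
    rw [show a = 1 from congrArg Subtype.val this, one_mul]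
    exact hc
  -- `P B` is the preimage of B under α and `ε B` the restriction of α to it. Each restriction is
  -- corrected by an inner automorphism of B; the product of the correcting elements `x B` corrects
  -- them all at once, since different factors commute.
  · let P : 𝒜 → 𝒜 := fun B => ⟨_, hmap α⁻¹ B B.2⟩
    let ε : ∀ B : 𝒜, ((P B : Subgroup N) ≃* (B : Subgroup N)) := fun B =>
      (MulEquiv.subgroupMap (α⁻¹ : MulAut N) B).symm
    have hε : ∀ B x, (ε B x : N) = α x := by
      intro B x
      obtain ⟨y, rfl⟩ := (ε B).symm.surjective x
      rw [(ε B).apply_symm_apply]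
      exact (α.apply_symm_apply y).symm
    choose x hx using fun B => C_ex (P B) B (ε B)
    have hprod : ∀ s : Finset 𝒜, ∃ n : N,
        (∀ B ∈ s, ∃ c ∈ Subgroup.centralizer ((B : Subgroup N) : Set N), x B * c = n) ∧
        ∀ B ∉ s, n ∈ Subgroup.centralizer ((B : Subgroup N) : Set N) := by
      classical
      intro s
      induction s using Finset.induction_on with
      | empty => exact ⟨1, by simp, fun B _ => Subgroup.one_mem _⟩
      | insert B s hB ih =>
        obtain ⟨n, h1, h2⟩ := ih
        have hxB : ∀ B' : 𝒜, B' ≠ B →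
            (x B : N) ∈ Subgroup.centralizer ((B' : Subgroup N) : Set N) := fun B' h =>
          hcomm B B.2 B' B'.2 (fun h' => h (Subtype.ext h'.symm)) (x B).2
        refine ⟨n * x B, fun B' hB' => ?_, fun B' hB' => ?_⟩
        · by_cases h : B' = B
          · subst h
            exact ⟨n, h2 B' hB, Subgroup.mem_centralizer_iff.1 (h2 B' hB) _ (x B').2⟩
          · obtain ⟨c, hc, rfl⟩ := h1 B' (Finset.mem_of_mem_insert_of_ne hB' h)
            exact ⟨c * x B, Subgroup.mul_mem _ hc (hxB B' h), (mul_assoc _ _ _).symm⟩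
        · rw [Finset.mem_insert, not_or] at hB'
          exact Subgroup.mul_mem _ (h2 B' hB'.2) (hxB B' hB'.1)
    have : Fintype 𝒜 := Fintype.ofFinite 𝒜
    obtain ⟨n, hn, -⟩ := hprod Finset.univ
    refine ⟨n, fun A B e he => ?_⟩
    have he' : ∀ a : (A : Subgroup N), (e a : N) = n * α a * n⁻¹ := he
    have hnorm := (hfac B B.2).normal
    have hA : A = P B := by
      refine Subtype.ext (Subgroup.ext fun a => ⟨fun ha => ⟨α a, ?_, α.symm_apply_apply a⟩, ?_⟩)
      · have := hnorm.conj_mem _ (e ⟨a, ha⟩).2 n⁻¹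
        rw [he'] at this
        simpa [mul_assoc] using this
      · rintro ⟨b, hb, rfl⟩
        have h1 := he' (e.symm ⟨_, hnorm.conj_mem b hb n⟩)
        rw [e.apply_symm_apply] at h1
        have h2 : b = α (e.symm ⟨_, hnorm.conj_mem b hb n⟩ : N) :=
          mul_left_cancel (mul_right_cancel h1)
        have h3 : α.symm b = (e.symm ⟨_, hnorm.conj_mem b hb n⟩ : N) := by
          rw [α.symm_apply_eq]
          exact h2
        exact (show (α⁻¹ : MulAut N) b = _ from h3) ▸ (e.symm ⟨_, hnorm.conj_mem b hb n⟩).2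
    subst hA
    convert hx B
    refine MulEquiv.ext fun a => Subtype.ext ?_
    obtain ⟨c, hc, hcn⟩ := hn B (Finset.mem_univ B)
    have h1 := Subgroup.mem_centralizer_iff.1 hc _ (ε B a).2
    rw [he', ← hε B a, ← hcn]
    change _ = (x B : N) * (ε B a : N) * (x B : N)⁻¹
    rw [mul_assoc _ c, ← h1]
    group

/-- A minimal nontrivial direct factor. -/
def IsMinimalFactor {N : Type u} [Group N] (A : Subgroup N) : Prop :=
  IsDirectFactor A ∧ A ≠ ⊥ ∧ ∀ D ≤ A, IsDirectFactor D → D = ⊥ ∨ D = A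

lemma isDirectFactor_top {N : Type u} [Group N] : IsDirectFactor (⊤ : Subgroup N) :=
  fun n => ⟨n, Subgroup.mem_top n, 1, Subgroup.one_mem _, mul_one n⟩

/-- By induction on D: if D is neither trivial nor minimal, it is the product of a proper direct
factor E and the proper direct factor C_N(E) ∩ D. -/
lemma isDirectFactor_le_of_minimal_le {N : Type u} [Group N] [Finite N]
    (hZ : Subgroup.center N = ⊥) {X : Subgroup N} (hX : ∀ A, IsMinimalFactor A → A ≤ X)
    (D : Subgroup N) (hD : IsDirectFactor D) : D ≤ X := by
  induction D using WellFoundedLT.induction with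
  | _ D ih =>
    by_cases hbot : D = ⊥
    · exact hbot ▸ bot_le
    by_cases hmin : ∀ E ≤ D, IsDirectFactor E → E = ⊥ ∨ E = D
    · exact hX D ⟨hD, hbot, hmin⟩
    push Not at hmin
    obtain ⟨E, hED, hE, hE0, hne⟩ := hmin
    have h1 : E ≤ X := ih E (lt_of_le_of_ne hED hne) hE
    have h2 : Subgroup.centralizer (E : Set N) ⊓ D ≤ X := by
      refine ih _ (lt_of_le_of_ne inf_le_right fun h => hE0 ?_) (hE.centralizer.inf hD hZ)
      rw [eq_bot_iff]
      intro x hx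
      exact hE.eq_one hZ hx (inf_eq_right.1 h (hED hx))
    intro d hd
    obtain ⟨a, ha, c, hc, rfl⟩ := hE d
    exact X.mul_mem (h1 ha) (h2 ⟨hc, (D.mul_mem_cancel_left (hED ha)).1 hd⟩)

/-- A centreless group generated by direct factors satisfying Rose's criterion satisfies it. -/
lemma roseCriterion_of_factors {N : Type u} [Group N] [Finite N] (hZ : Subgroup.center N = ⊥)
    {ι : Type v} (D : ι → Subgroup N) (hD : ∀ i, IsDirectFactor (D i))
    (hgen : ∀ x : N, (∀ i, x ∈ Subgroup.centralizer (D i : Set N)) → x = 1)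
    (hrose : ∀ i, RoseCriterion (D i)) : RoseCriterion N := by
  refine roseCriterion_of_permuted_factors {A | IsMinimalFactor A} ?_ (fun A hA => hA.1) ?_ ?_ ?_
  · rintro α A ⟨hA, hA0, hmin⟩
    refine ⟨hA.map α, ?_, fun E hE hEf => ?_⟩
    · rwa [Ne, Subgroup.map_eq_bot_iff_of_injective _ α.injective]
    · have hcancel : (E.map α.symm.toMonoidHom).map α.toMonoidHom = E := by
        rw [Subgroup.map_map]
        convert E.map_id
        ext x
        simp
      have hle : E.map α.symm.toMonoidHom ≤ A := by
        rintro _ ⟨x, hx, rfl⟩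
        obtain ⟨a, ha, rfl⟩ := hE hx
        simpa using ha
      rcases hmin _ hle (hEf.map α.symm) with h | h
      · left
        rw [← hcancel, h, Subgroup.map_bot]
      · right
        rw [← hcancel, h]
  · rintro A ⟨hA, hA0, hAm⟩ B ⟨hB, hB0, hBm⟩ hne
    refine hA.commute_of_inf_eq_bot hB hZ ?_
    rcases hAm _ inf_le_left (hA.inf hB hZ) with h | h
    · exact h
    rcases hBm _ inf_le_right (hA.inf hB hZ) with h' | h'
    · exact h'
    exact absurd (h.symm.trans h') hne
  · intro x hx
    have : (⊤ : Subgroup N) ≤ Subgroup.centralizer {x} := by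
      refine isDirectFactor_le_of_minimal_le hZ (fun A hA a ha => ?_) _ isDirectFactor_top
      rw [Subgroup.mem_centralizer_singleton_iff]
      exact Subgroup.mem_centralizer_iff.1 (hx A hA) a ha
    have hxc : x ∈ Subgroup.center N := by
      rw [Subgroup.mem_center_iff]
      intro g
      exact Subgroup.mem_centralizer_singleton_iff.1 (this (Subgroup.mem_top g))
    rwa [hZ, Subgroup.mem_bot] at hxc
  · rintro A ⟨hA, hA0, hAm⟩
    -- Otherwise minimality forces A ∩ D_i = 1 for every i, so A centralizes all D_i and is trivial.
    obtain ⟨i, hi⟩ : ∃ i, A ≤ D i := by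
      by_contra! hcon
      refine hA0 (eq_bot_iff.2 fun a ha => hgen a fun i => ?_)
      refine hA.commute_of_inf_eq_bot (hD i) hZ ?_ ha
      rcases hAm _ inf_le_left (hA.inf (hD i) hZ) with h | h
      · exact h
      · exact absurd (inf_eq_left.1 h) (hcon i)
    exact ((hrose i).of_isDirectFactor (hA.subgroupOf hi)).of_mulEquiv
      (Subgroup.subgroupOfEquivOfLe hi)

/-! ### Direct products as groups generated by direct factors. -/

lemma isDirectFactor_range_mulSingle {ι : Type} [DecidableEq ι] (N : ι → Type u)
    [∀ i, Group (N i)] (i : ι) : IsDirectFactor (MonoidHom.mulSingle N i).range := by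
  intro n
  refine ⟨_, ⟨n i, rfl⟩, Function.update n i 1, ?_, ?_⟩
  · rw [Subgroup.mem_centralizer_iff]
    rintro _ ⟨y, rfl⟩
    ext j
    by_cases h : j = i
    · subst h
      simp
    · simp [h]
  · ext j
    by_cases h : j = i
    · subst h
      simp
    · simp [h]

/-- Rose's criterion for a direct product. -/
theorem roseCriterion_pi_iff {ι : Type} [Finite ι] (N : ι → Type u) [∀ i, Group (N i)]
    [∀ i, Finite (N i)] : RoseCriterion (∀ i, N i) ↔ ∀ i, RoseCriterion (N i) := by
  classical
  have hinj : ∀ i, Function.Injective (MonoidHom.mulSingle N i) := fun i => Pi.mulSingle_injective i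
  constructor
  · intro h i
    exact (h.of_isDirectFactor (isDirectFactor_range_mulSingle N i)).of_mulEquiv
      (MonoidHom.ofInjective (hinj i)).symm
  · intro h
    have hgen : ∀ x : ∀ i, N i,
        (∀ i, x ∈ Subgroup.centralizer ((MonoidHom.mulSingle N i).range : Set (∀ i, N i))) →
          x = 1 := by
      intro x hx
      ext i
      have : x i ∈ Subgroup.center (N i) := by
        rw [Subgroup.mem_center_iff]
        intro y
        have := congrFun (Subgroup.mem_centralizer_iff.1 (hx i) _ ⟨y, rfl⟩) i
        simpa using this
      rwa [(h i).1, Subgroup.mem_bot] at this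
    refine roseCriterion_of_factors ?_ _ (isDirectFactor_range_mulSingle N) hgen fun i =>
      (h i).of_mulEquiv (MonoidHom.ofInjective (hinj i))
    rw [eq_bot_iff]
    exact fun x hx => hgen x fun i => Subgroup.center_le_centralizer _ hx

/-! ### Gaschütz' theorem for products of characteristic subgroups -/

lemma map_mk_sup_left {G : Type u} [Group G] (A B : Subgroup G) [B.Normal] :
    (A ⊔ B).map (QuotientGroup.mk' B) = A.map (QuotientGroup.mk' B) := by
  rw [Subgroup.map_sup, QuotientGroup.map_mk'_self, sup_bot_eq]

/-- If `A ∩ B = 1` then the image of `A` in `G / B` is isomorphic to `A`. -/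
lemma GaschuetzHolds.map_mk {G : Type u} [Group G] {A B : Subgroup G} [B.Normal]
    (h : GaschuetzHolds A) (hAB : A ⊓ B = ⊥) : GaschuetzHolds (A.map (QuotientGroup.mk' B)) := by
  let f := (QuotientGroup.mk' B).subgroupMap A
  have hf : Function.Injective f := by
    rw [injective_iff_map_eq_one]
    rintro ⟨a, ha⟩ h1
    have h2 : (QuotientGroup.mk' B) a = 1 := congrArg Subtype.val h1
    exact Subtype.ext (eq_one_of_mem_of_inf_eq_bot hAB ha ((QuotientGroup.eq_one_iff a).1 h2))
  exact h.of_mulEquiv (MulEquiv.ofBijective f ⟨hf, (QuotientGroup.mk' B).subgroupMap_surjective A⟩)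

/-- If `J` complements `A × B` in `H` and `L` contains `B`, then `B` is complemented in `H ∩ L`. -/
lemma exists_complement_inf {G : Type u} [Group G] {A B J H L : Subgroup G} [A.Normal]
    [B.Normal] (hAB : A ⊓ B = ⊥) (h1 : (A ⊔ B) ⊓ J = ⊥) (h2 : (A ⊔ B) ⊔ J = H) (hBL : B ≤ L) :
    ∃ J' : Subgroup G, B ⊓ J' = ⊥ ∧ B ⊔ J' = H ⊓ L := by
  -- AJ complements B in H, and intersecting with L ≥ B preserves this by Dedekind's law.
  refine ⟨(A ⊔ J) ⊓ L, ?_, le_antisymm (sup_le ?_ ?_) ?_⟩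
  · rw [eq_bot_iff]
    rintro b ⟨hb, hb', -⟩
    obtain ⟨a, ha, j, hj, rfl⟩ := Subgroup.mem_sup_of_normal_left.1 hb'
    have hjAB : j ∈ A ⊔ B := by
      rw [← inv_mul_cancel_left a j]
      exact Subgroup.mul_mem_sup (A.inv_mem ha) hb
    have hj1 : j = 1 := eq_one_of_mem_of_inf_eq_bot h1 hjAB hj
    rw [hj1, mul_one] at hb ⊢
    exact hAB ▸ Subgroup.mem_inf.2 ⟨ha, hb⟩
  · exact le_inf (h2 ▸ le_sup_of_le_left le_sup_right) hBL
  · exact inf_le_inf_right _ (h2 ▸ sup_le (le_sup_of_le_left le_sup_left) le_sup_right)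
  · rintro x ⟨hxH, hxL⟩
    have hx : x ∈ B ⊔ (A ⊔ J) := by
      rwa [← sup_assoc, sup_comm B A, h2]
    obtain ⟨b, hb, y, hy, rfl⟩ := Subgroup.mem_sup_of_normal_left.1 hx
    exact Subgroup.mul_mem_sup hb ⟨hy, (L.mul_mem_cancel_left (hBL hb)).1 hxL⟩

/-- For `G = N L` and `N ≤ H` the subgroup `H ∩ L` has the same index in `L` as `H` in `G`. -/
lemma relIndex_eq_index_of_sup_eq_top {G : Type u} [Group G] {N H L : Subgroup G} [N.Normal]
    (hNH : N ≤ H) (h : N ⊔ L = ⊤) : H.relIndex L = H.index := by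
  have hs : Function.Surjective ((QuotientGroup.mk' N).comp L.subtype) := by
    intro q
    obtain ⟨g, rfl⟩ := QuotientGroup.mk'_surjective N q
    obtain ⟨n, hn, l, hl, rfl⟩ := exists_mul_of_sup_eq h (Subgroup.mem_top g)
    refine ⟨⟨l, hl⟩, ?_⟩
    have : (QuotientGroup.mk' N) n = 1 := (QuotientGroup.eq_one_iff n).2 hn
    rw [map_mul, this, one_mul]
    rfl
  have hH : (H.map (QuotientGroup.mk' N)).comap (QuotientGroup.mk' N) = H := by
    rw [Subgroup.comap_map_eq, QuotientGroup.ker_mk', sup_eq_left.2 hNH]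
  have hL : H.subgroupOf L =
      (H.map (QuotientGroup.mk' N)).comap ((QuotientGroup.mk' N).comp L.subtype) := by
    rw [← Subgroup.comap_comap, hH]
    rfl
  rw [Subgroup.relIndex, hL, Subgroup.index_comap_of_surjective _ hs,
    ← Subgroup.index_comap_of_surjective _ (QuotientGroup.mk'_surjective N), hH]

lemma biSup_subgroupOf {G : Type u} [Group G] {ι : Type v} (F : ι → Subgroup G) (s : Set ι)
    (L : Subgroup G) (hL : ∀ i ∈ s, F i ≤ L) :
    ⨆ i ∈ s, (F i).subgroupOf L = (⨆ i ∈ s, F i).subgroupOf L := by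
  apply Subgroup.map_injective L.subtype_injective
  rw [Subgroup.map_subgroupOf_eq_of_le (iSup₂_le hL), Subgroup.map_iSup]
  refine iSup_congr fun i => ?_
  rw [Subgroup.map_iSup]
  exact iSup_congr fun hi => Subgroup.map_subgroupOf_eq_of_le (hL i hi)

/-- The ambient group is quantified inside the induction because the inductive step replaces G by
the supplement L. Normality of the factors in G, rather than characteristicity, is what passes to L.
-/
lemma exists_complement_biSup {ι : Type v} (s : Finset ι) :
    ∀ (G : Type u) [Group G] [Finite G] (F : ι → Subgroup G), (∀ i, (F i).Normal) →
      (∀ i ∈ s, F i ⊓ (⨆ j ∈ (s : Set ι) \ {i}, F j) = ⊥) → (∀ i ∈ s, GaschuetzHolds (F i)) →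
      ∀ H J : Subgroup G, (Nat.card ↥(⨆ i ∈ (s : Set ι), F i)).Coprime H.index →
        (⨆ i ∈ (s : Set ι), F i) ⊓ J = ⊥ → (⨆ i ∈ (s : Set ι), F i) ⊔ J = H →
        HasComplement (⨆ i ∈ (s : Set ι), F i) := by
  classical
  induction s using Finset.induction_on with
  | empty =>
    intro G _ _ F _ _ _ H J _ _ _
    refine ⟨⊤, ?_⟩
    simp only [Finset.coe_empty, Set.mem_empty_iff_false, iSup_false, iSup_bot]
    exact Subgroup.isComplement'_bot_top
  | insert i s hi ih =>
    intro G _ _ F hF hind hG H J hc h1 h2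
    have := hF
    set B : Subgroup G := ⨆ j ∈ (s : Set ι), F j with hB
    have hBn : B.Normal := by
      rw [hB]
      infer_instance
    have hN : (⨆ j ∈ ((insert i s : Finset ι) : Set ι), F j) = F i ⊔ B := by
      rw [Finset.coe_insert, iSup_insert]
    have hdiff : (((insert i s : Finset ι) : Set ι)) \ {i} = s := by
      rw [Finset.coe_insert, Set.insert_sdiff_self_of_notMem (by simpa using hi)]
    have hAB : F i ⊓ B = ⊥ := by
      have := hind i (Finset.mem_insert_self i s)
      rwa [hdiff] at this
    rw [hN] at hc h1 h2 ⊢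
    obtain ⟨L, hL1, hL2, hL3⟩ := exists_supplement (M := B) (N := F i ⊔ B) le_sup_right
      (by
        rw [map_mk_sup_left]
        exact (hG i (Finset.mem_insert_self i s)).map_mk hAB) hc h1 h2
    obtain ⟨J', hJ1, hJ2⟩ := exists_complement_inf hAB h1 h2 hL1
    have hsL : (⨆ j ∈ (s : Set ι), (F j).subgroupOf L) = B.subgroupOf L :=
      biSup_subgroupOf F s L fun j hj => (le_iSup₂ (f := fun j _ => F j) j hj).trans hL1
    have key := ih L (fun j => (F j).subgroupOf L) (fun j => inferInstance) ?_ ?_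
      (H.subgroupOf L) (J'.subgroupOf L) ?_ ?_ ?_
    · rw [hsL] at key
      obtain ⟨Q, hQ1, hQ2⟩ := (hasComplement_subgroupOf_iff hL1).1 key
      exact hasComplement_of_supplement le_sup_right hL2 hL3 hQ1 hQ2
    · intro j hj
      rw [biSup_subgroupOf F _ L fun k hk =>
        (le_iSup₂ (f := fun j _ => F j) k hk.1).trans hL1]
      refine (Subgroup.comap_inf _ _ L.subtype).symm.trans ?_
      have : F j ⊓ (⨆ k ∈ (s : Set ι) \ {j}, F k) = ⊥ := by
        rw [eq_bot_iff, ← hind j (Finset.mem_insert_of_mem hj)]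
        refine inf_le_inf_left _ (biSup_mono fun k hk => ⟨?_, hk.2⟩)
        exact Finset.mem_insert_of_mem hk.1
      rw [this]
      exact Subgroup.bot_subgroupOf L
    · intro j hj
      exact (hG j (Finset.mem_insert_of_mem hj)).of_mulEquiv (Subgroup.subgroupOfEquivOfLe
        ((le_iSup₂ (f := fun j _ => F j) j hj).trans hL1)).symm
    · rw [hsL]
      change Nat.Coprime _ (H.relIndex L)
      rw [relIndex_eq_index_of_sup_eq_top (h2 ▸ le_sup_left) hL3,
        Nat.card_congr (Subgroup.subgroupOfEquivOfLe hL1).toEquiv]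
      exact hc.coprime_dvd_left (Subgroup.card_dvd_of_le le_sup_right)
    · rw [hsL]
      refine (Subgroup.comap_inf _ _ L.subtype).symm.trans ?_
      rw [hJ1]
      exact Subgroup.bot_subgroupOf L
    · have hJL : J' ≤ L := (hJ2 ▸ le_sup_right : J' ≤ H ⊓ L).trans inf_le_right
      rw [hsL, ← Subgroup.subgroupOf_sup hL1 hJL, hJ2, Subgroup.inf_subgroupOf_right]

theorem gaschuetzHolds_of_isInternalDirectProduct {N : Type u} [Group N] {ι : Type v} [Finite ι]
    (F : ι → Subgroup N) (hF : IsInternalDirectProduct F) (hchar : ∀ i, (F i).Characteristic)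
    (h : ∀ i, GaschuetzHolds (F i)) : GaschuetzHolds N := by
  refine gaschuetzHolds_of_forall fun G _ _ f hf hn H J hc h1 h2 => ?_
  have := Fintype.ofFinite ι
  have hsup : (⨆ i ∈ ((Finset.univ : Finset ι) : Set ι), (F i).map f) = f.range := by
    simp only [Finset.coe_univ, Set.mem_univ, iSup_pos]
    rw [← Subgroup.map_iSup, hF.2.1, MonoidHom.range_eq_map]
  rw [← hsup] at hc h1 h2 ⊢
  refine exists_complement_biSup Finset.univ G _
    (fun i => normal_map_of_characteristic hf hn (F i)) (fun i _ => ?_)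
    (fun i _ => (h i).of_mulEquiv ((F i).equivMapOfInjective f hf)) H J hc h1 h2
  have hmap : (⨆ j ∈ ((Finset.univ : Finset ι) : Set ι) \ {i}, (F j).map f) =
      (⨆ j, ⨆ _ : j ≠ i, F j).map f := by
    simp [Subgroup.map_iSup]
  rw [hmap, ← Subgroup.map_inf _ _ f hf, hF.2.2 i, Subgroup.map_bot]

/-! ### Characteristic subgroups satisfying Rose's criterion. -/

theorem gaschuetzHolds_of_roseCriterion {N : Type u} [Group N] (M : Subgroup N)
    [M.Characteristic] (hM : RoseCriterion M) (h : GaschuetzHolds (N ⧸ M)) :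
    GaschuetzHolds N := by
  refine gaschuetzHolds_of_forall fun G _ _ f hf hn H J hc h1 h2 => ?_
  have hMn := normal_map_of_characteristic hf hn M
  have hMN : M.map f ≤ f.range := Subgroup.map_le_range f M
  obtain ⟨L, hL1, hL2, hL3⟩ := exists_supplement hMN
    (h.of_mulEquiv (quotientEquivMapMk hf M)) hc h1 h2
  have hR : RoseCriterion ((M.map f).subgroupOf L) :=
    hM.of_mulEquiv ((M.equivMapOfInjective f hf).trans (Subgroup.subgroupOfEquivOfLe hL1).symm)
  obtain ⟨Q, hQ1, hQ2⟩ := (hasComplement_subgroupOf_iff hL1).1 hR.hasComplement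
  exact hasComplement_of_supplement hMN hL2 hL3 hQ1 hQ2

/-! ### Complements containing commutators of the centralizer -/

open scoped commutatorElement

section CyclicShift

variable {G : Type u} [Group G]

/-- The functions to `G` all of whose values are congruent modulo the normal subgroup `C`. -/
def congruentFunctions (C : Subgroup G) [hC : C.Normal] (S : Type v) : Subgroup (S → G) where
  carrier := {h | ∀ i j, (h i)⁻¹ * h j ∈ C}
  one_mem' := fun i j => by simp
  mul_mem' := by
    intro a b ha hb i j
    have h1 := hC.conj_mem _ (ha i j) (b i)⁻¹
    have h2 := C.mul_mem h1 (hb i j)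
    convert h2 using 1
    simp only [Pi.mul_apply]
    group
  inv_mem' := by
    intro a ha i j
    have h1 := hC.conj_mem _ (ha j i) (a j)
    convert h1 using 1
    simp only [Pi.inv_apply]
    group

variable {C : Subgroup G} [hC : C.Normal] {S : Type} [Group S]

/-- The regular translation action on functions with congruent values. -/
def translation (C : Subgroup G) [hC : C.Normal] (S : Type) [Group S] :
    S →* MulAut (congruentFunctions C S) where
  toFun σ :=
    { toFun := fun h => ⟨fun i => h.1 (σ⁻¹ * i), fun i j => h.2 _ _⟩
      invFun := fun h => ⟨fun i => h.1 (σ * i), fun i j => h.2 _ _⟩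
      left_inv := fun h => Subtype.ext (funext fun i => by simp)
      right_inv := fun h => Subtype.ext (funext fun i => by simp)
      map_mul' := fun _ _ => rfl }
  map_one' := MulEquiv.ext fun h => Subtype.ext (funext fun i => by simp)
  map_mul' σ τ := MulEquiv.ext fun h => Subtype.ext (funext fun i => by simp [mul_assoc])

lemma translation_apply (σ : S) (h : congruentFunctions C S) (i : S) :
    (translation C S σ h).1 i = h.1 (σ⁻¹ * i) := rfl

/-- Constant functions. -/
def constFunction (C : Subgroup G) [hC : C.Normal] (S : Type) : G →* congruentFunctions C S where
  toFun g := ⟨fun _ => g, fun _ _ => by simp⟩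
  map_one' := rfl
  map_mul' _ _ := rfl

/-- Functions supported at one point. -/
def singleFunction [DecidableEq S] (i : S) (c : C) : congruentFunctions C S :=
  ⟨Pi.mulSingle i (c : G), fun j k => by
    have h : ∀ j, (Pi.mulSingle i (c : G) : S → G) j ∈ C := by
      intro j
      by_cases hj : j = i
      · subst hj
        simp
      · simp [hj]
    exact C.mul_mem (C.inv_mem (h j)) (h k)⟩

lemma mul_inv_mem_of_congruent {ι : Type v} (h : congruentFunctions C ι) (i j : ι) :
    h.1 i * (h.1 j)⁻¹ ∈ C := by
  have := (h⁻¹).2 i j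
  simpa using this

/-- The commutator of two functions supported at two points each, the supports meeting in `i`. -/
lemma commutator_single [DecidableEq S] {σ : S} (h1 : σ ≠ 1) (h2 : σ * σ ≠ 1) (i : S) (c d : C) :
    ⁅singleFunction i c * (translation C S σ (singleFunction i c))⁻¹,
      singleFunction i d * (translation C S σ⁻¹ (singleFunction i d))⁻¹⁆ =
      singleFunction i ⁅c, d⁆ := by
  refine Subtype.ext (funext fun j => ?_)
  have e1 : ∀ τ : S, τ * j = i ↔ j = τ⁻¹ * i := fun τ => eq_inv_mul_iff_mul_eq.symm
  simp only [commutatorElement_def, Subgroup.coe_mul, Subgroup.coe_inv, Pi.mul_apply, Pi.inv_apply,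
    translation_apply, singleFunction, Pi.mulSingle_apply, inv_inv, e1]
  -- The two factors are supported on {i, σi} and {i, σ⁻¹i}. These sets meet only in i because σ² ≠
  -- 1, and σ ≠ 1 keeps the translates away from i.
  by_cases hi : j = i
  · subst hi
    have e2 : j ≠ σ * j := fun h => h1 (by simpa using h)
    have e3 : j ≠ σ⁻¹ * j := fun h => h1 (by simpa using h)
    simp [e2, e3]
  · by_cases hj : j = σ * i
    · have e4 : j ≠ σ⁻¹ * i := by
        intro h
        rw [hj, eq_inv_mul_iff_mul_eq, ← mul_assoc] at h
        exact h2 (by simpa using h)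
      simp only [hi, e4, if_false]
      split_ifs
      simp
    · simp only [hi, hj, if_false]
      split_ifs <;> simp

end CyclicShift

lemma eq_one_of_pow_eq_one_of_coprime {G : Type u} [Group G] {x : G} {m n : ℕ} (h1 : x ^ m = 1)
    (h2 : x ^ n = 1) (h : m.Coprime n) : x = 1 := by
  have := pow_gcd_eq_one.2 ⟨h1, h2⟩
  rwa [h.gcd_eq_one, pow_one] at this

/-- If Gaschütz' theorem holds for the complemented normal subgroup `K`, then `K` has a complement
that contains the derived subgroup of the centralizer of `K`. -/
theorem GaschuetzHolds.exists_complement_commutator_le {G : Type u} [Group G] [Finite G]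
    {K : Subgroup G} [K.Normal] (hK : GaschuetzHolds K) {W : Subgroup G} (h1 : K ⊓ W = ⊥)
    (h2 : K ⊔ W = ⊤) :
    ∃ W' : Subgroup G, K ⊓ W' = ⊥ ∧ K ⊔ W' = ⊤ ∧
      ⁅Subgroup.centralizer (K : Set G), Subgroup.centralizer (K : Set G)⁆ ≤ W' := by
  classical
  set C : Subgroup G := Subgroup.centralizer (K : Set G) with hCdef
  have hCK : ∀ c ∈ C, ∀ k ∈ K, k * c = c * k := fun c hc k hk =>
    Subgroup.mem_centralizer_iff.1 hc k hk
  -- A prime above |G| is coprime to |K|; the extra 3 ensures that a generator of the cyclic group S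
  -- has σ² ≠ 1.
  obtain ⟨s, hs, hsp⟩ := Nat.exists_infinite_primes (Nat.card G + 3)
  have : NeZero s := ⟨hsp.ne_zero⟩
  let S := Multiplicative (ZMod s)
  have hcardS : Nat.card S = s := Nat.card_zmod s
  have hcop : (Nat.card K).Coprime s := by
    refine Nat.Coprime.symm ((Nat.Prime.coprime_iff_not_dvd hsp).2 fun h => ?_)
    have h3 := Nat.le_of_dvd Nat.card_pos h
    have h4 := Subgroup.card_le_card_group K
    omega
  let Γ := congruentFunctions C S ⋊[translation C S] S
  have : Finite Γ := Finite.of_equiv _ (SemidirectProduct.equivProd).symm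
  let δ : G →* Γ := SemidirectProduct.inl.comp (constFunction C S)
  have hδ : Function.Injective δ := by
    intro a b hab
    have := SemidirectProduct.inl_injective hab
    exact congrFun (congrArg Subtype.val this) 1
  let f : K →* Γ := δ.comp K.subtype
  have hf : Function.Injective f := hδ.comp K.subtype_injective
  have hinr : ∀ (g : G) (σ : S), δ g * SemidirectProduct.inr σ = SemidirectProduct.inr σ * δ g := by
    intro g σ
    have h3 : δ g = SemidirectProduct.inr σ * δ g * SemidirectProduct.inr σ⁻¹ :=
      SemidirectProduct.inl_aut σ (constFunction C S g)
    rwa [map_inv, eq_mul_inv_iff_mul_eq] at h3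
  -- The values of h are congruent modulo C, which centralizes K, so they all conjugate k alike.
  -- This is why the diagonal copy of K is normal in Γ.
  have hinl : ∀ (h : congruentFunctions C S) (k : K),
      SemidirectProduct.inl h * f k * (SemidirectProduct.inl h)⁻¹ = δ (h.1 1 * k * (h.1 1)⁻¹) := by
    intro h k
    change SemidirectProduct.inl h * SemidirectProduct.inl (constFunction C S k) *
      (SemidirectProduct.inl h)⁻¹ = SemidirectProduct.inl (constFunction C S _)
    rw [← map_inv, ← map_mul, ← map_mul]
    refine congrArg _ (Subtype.ext (funext fun i => ?_))
    change h.1 i * k * (h.1 i)⁻¹ = h.1 1 * k * (h.1 1)⁻¹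
    have h3 := hCK _ (h.2 1 i) k k.2
    calc h.1 i * k * (h.1 i)⁻¹ = h.1 1 * ((h.1 1)⁻¹ * h.1 i * k) * (h.1 i)⁻¹ := by group
      _ = h.1 1 * k * (h.1 1)⁻¹ := by rw [← h3]; group
  have hn : f.range.Normal := by
    refine ⟨?_⟩
    rintro _ ⟨k, rfl⟩ x
    have hx : x * f k * x⁻¹ = SemidirectProduct.inl x.left * f k *
        (SemidirectProduct.inl x.left)⁻¹ := by
      conv_lhs => rw [← SemidirectProduct.inl_left_mul_inr_right x]
      rw [mul_assoc _ _ (f k), show SemidirectProduct.inr x.right * f k =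
        f k * SemidirectProduct.inr x.right from (hinr k x.right).symm, mul_inv_rev]
      simp only [mul_assoc, mul_inv_cancel_left]
    rw [hx, hinl]
    exact ⟨⟨_, ‹K.Normal›.conj_mem k k.2 _⟩, rfl⟩
  let H : Subgroup Γ := (SemidirectProduct.inl : congruentFunctions C S →* Γ).range
  have hHi : H.index = s := by
    rw [show H = SemidirectProduct.rightHom.ker from SemidirectProduct.range_inl_eq_ker_rightHom,
      Subgroup.index_ker, MonoidHom.range_eq_top.2 SemidirectProduct.rightHom_surjective,
      Subgroup.card_top, hcardS]
  have hfH : f.range ≤ H := by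
    rintro _ ⟨k, rfl⟩
    exact ⟨_, rfl⟩
  let ev : congruentFunctions C S →* G := (Pi.evalMonoidHom (fun _ : S => G) 1).comp
    (congruentFunctions C S).subtype
  -- In the base group, the functions with value at 1 in W complement the diagonal K.
  have hJ : HasComplement (f.range.subgroupOf H) := by
    refine (hasComplement_subgroupOf_iff hfH).2
      ⟨(W.comap ev).map SemidirectProduct.inl, ?_, le_antisymm (sup_le hfH ?_) ?_⟩
    · rw [eq_bot_iff]
      rintro _ ⟨⟨k, rfl⟩, h, hh, hhk⟩
      have h3 : h = constFunction C S k := SemidirectProduct.inl_injective hhk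
      subst h3
      have h4 : (k : G) = 1 := eq_one_of_mem_of_inf_eq_bot h1 k.2 hh
      have h5 : k = 1 := Subtype.ext h4
      rw [h5, map_one]
      exact Subgroup.one_mem _
    · exact Subgroup.map_le_range _ _
    · rintro _ ⟨h, rfl⟩
      obtain ⟨k, hk, w, hw, hkw⟩ := exists_mul_of_sup_eq h2 (Subgroup.mem_top (ev h))
      have h3 : SemidirectProduct.inl h = f ⟨k, hk⟩ *
          SemidirectProduct.inl ((constFunction C S k)⁻¹ * h) := by
        rw [map_mul, map_inv]
        exact (mul_inv_cancel_left _ _).symm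
      rw [h3]
      refine Subgroup.mul_mem_sup ⟨_, rfl⟩ ⟨_, ?_, rfl⟩
      change k⁻¹ * ev h ∈ W
      rwa [← hkw, inv_mul_cancel_left]
  obtain ⟨T, hT1, hT2⟩ := (hasComplement_iff_of_normal f.range).1
    (hK Γ f hf hn H hfH (hHi.symm ▸ hcop) hJ)
  have hdec : ∀ x : Γ, ∃ k : K, ∃ t ∈ T, f k * t = x := by
    intro x
    obtain ⟨_, ⟨k, rfl⟩, t, ht, hx⟩ := exists_mul_of_sup_eq hT2 (Subgroup.mem_top x)
    exact ⟨k, t, ht, hx⟩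
  -- Write σ = kt. Since k and t commute, σ^s = 1 puts k^s in K ∩ T = 1, and s is coprime to |K|, so
  -- k = 1.
  have hST : ∀ σ : S, SemidirectProduct.inr σ ∈ T := by
    intro σ
    obtain ⟨k, t, ht, hx⟩ := hdec (SemidirectProduct.inr σ)
    have hcomm : Commute (f k) t := by
      have h3 : t = (f k)⁻¹ * SemidirectProduct.inr σ := by rw [← hx, inv_mul_cancel_left]
      rw [h3]
      exact (Commute.refl (f k)).inv_right.mul_right (hinr k σ)
    have hσ : (SemidirectProduct.inr σ : Γ) ^ s = 1 := by
      have h3 : σ ^ Nat.card S = 1 := pow_card_eq_one'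
      rw [hcardS] at h3
      rw [← map_pow, h3, map_one]
    rw [← hx, hcomm.mul_pow, ← map_pow] at hσ
    have h3 : f (k ^ s) = 1 := by
      refine eq_one_of_mem_of_inf_eq_bot hT1 ⟨_, rfl⟩ ?_
      rw [eq_inv_of_mul_eq_one_left hσ]
      exact T.inv_mem (T.pow_mem ht s)
    have h4 : k = 1 := eq_one_of_pow_eq_one_of_coprime pow_card_eq_one'
      ((map_eq_one_iff f hf).1 h3) hcop
    rw [← hx, h4, map_one, one_mul]
    exact ht
  have hcomm_f : ∀ h : congruentFunctions C S, (∀ i, h.1 i ∈ C) → ∀ k : K,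
      f k * SemidirectProduct.inl h = SemidirectProduct.inl h * f k := by
    intro h hh k
    change SemidirectProduct.inl (constFunction C S k) * SemidirectProduct.inl h =
      SemidirectProduct.inl h * SemidirectProduct.inl (constFunction C S k)
    rw [← map_mul, ← map_mul]
    exact congrArg _ (Subtype.ext (funext fun i => hCK _ (hh i) k k.2))
  -- With h = kt, the element is [h, σ] = k[t, σ]k⁻¹. Its values lie in C, so it commutes with k and
  -- equals [t, σ], which is in T.
  have hcomm_mem : ∀ (h : congruentFunctions C S) (σ : S),
      SemidirectProduct.inl (h * (translation C S σ h)⁻¹) ∈ T := by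
    intro h σ
    obtain ⟨k, t, ht, hx⟩ := hdec (SemidirectProduct.inl h)
    have h3 : (SemidirectProduct.inl (h * (translation C S σ h)⁻¹) : Γ) =
        SemidirectProduct.inl h * SemidirectProduct.inr σ * (SemidirectProduct.inl h)⁻¹ *
          (SemidirectProduct.inr σ)⁻¹ := by
      rw [map_mul, map_inv, SemidirectProduct.inl_aut, map_inv]
      group
    have h4 : (SemidirectProduct.inl (h * (translation C S σ h)⁻¹) : Γ) =
        f k * (t * SemidirectProduct.inr σ * t⁻¹ * (SemidirectProduct.inr σ)⁻¹) * (f k)⁻¹ := by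
      have h5 : (SemidirectProduct.inr σ)⁻¹ * (f k)⁻¹ = (f k)⁻¹ * (SemidirectProduct.inr σ)⁻¹ := by
        rw [← mul_inv_rev, ← mul_inv_rev]
        exact congrArg _ (hinr k σ)
      rw [h3, ← hx, mul_inv_rev]
      simp only [mul_assoc]
      rw [h5]
    have h6 := hcomm_f (h * (translation C S σ h)⁻¹)
      (fun i => mul_inv_mem_of_congruent h i (σ⁻¹ * i)) k
    rw [eq_mul_inv_iff_mul_eq, ← h6] at h4
    rw [mul_left_cancel h4]
    exact T.mul_mem (T.mul_mem (T.mul_mem ht (hST σ)) (T.inv_mem ht)) (T.inv_mem (hST σ))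
  have hs3 : 3 ≤ s := le_trans (Nat.le_add_left 3 _) hs
  let σ : S := Multiplicative.ofAdd 1
  have hσs : orderOf σ = s := by
    rw [orderOf_ofAdd_eq_addOrderOf, ZMod.addOrderOf_one]
  have hσ1 : σ ≠ 1 := by
    intro h
    rw [h, orderOf_one] at hσs
    omega
  have hσ2 : σ * σ ≠ 1 := by
    intro h
    rw [← pow_two] at h
    have := Nat.le_of_dvd two_pos (orderOf_dvd_of_pow_eq_one h)
    omega
  have hsingle : ∀ (i : S) (c d : C), SemidirectProduct.inl (singleFunction i ⁅c, d⁆) ∈ T := by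
    intro i c d
    rw [← commutator_single hσ1 hσ2, map_commutatorElement, commutatorElement_def]
    exact T.mul_mem (T.mul_mem (T.mul_mem (hcomm_mem _ _) (hcomm_mem _ _))
      (T.inv_mem (hcomm_mem _ _))) (T.inv_mem (hcomm_mem _ _))
  refine ⟨T.comap δ, ?_, ?_, ?_⟩
  · rw [eq_bot_iff]
    rintro k ⟨hk, hkT⟩
    have h3 : f ⟨k, hk⟩ = 1 := eq_one_of_mem_of_inf_eq_bot hT1 ⟨_, rfl⟩ hkT
    exact congrArg Subtype.val ((map_eq_one_iff f hf).1 h3)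
  · rw [eq_top_iff]
    intro g _
    obtain ⟨k, t, ht, hx⟩ := hdec (δ g)
    rw [← mul_inv_cancel_left (k : G) g]
    refine Subgroup.mul_mem_sup k.2 ?_
    change δ ((k : G)⁻¹ * g) ∈ T
    have h3 : δ ((k : G)⁻¹ * g) = t := by
      rw [map_mul, ← hx, map_inv]
      exact inv_mul_cancel_left _ _
    rwa [h3]
  · rw [Subgroup.commutator_le]
    intro c hc d hd
    -- The constant function is the product of its one-point parts, all of which lie in T.
    have h3 : (constFunction C S ⁅c, d⁆).1 ∈
        (T.comap SemidirectProduct.inl).map (congruentFunctions C S).subtype := by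
      refine Subgroup.pi_mem_of_mulSingle_mem _ fun i => ?_
      exact ⟨_, hsingle i ⟨c, hc⟩ ⟨d, hd⟩, rfl⟩
    obtain ⟨y, hy, hyc⟩ := h3
    have h4 : y = constFunction C S ⁅c, d⁆ := Subtype.ext hyc
    subst h4
    exact hy

/-! ### Applications of the Schur–Zassenhaus theorem -/

lemma pow_card_eq_one_of_mem {G : Type u} [Group G] {H : Subgroup G} {x : G} (hx : x ∈ H) :
    x ^ Nat.card H = 1 :=
  congrArg Subtype.val (pow_card_eq_one' (x := (⟨x, hx⟩ : H)))

/-- If every prime divisor `p` of `n` admits no element of `B` of order `p` modulo `Y`, then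
`|B : Y ∩ B|` is coprime to `n`. -/
lemma coprime_relIndex_of_forall {G : Type u} [Group G] [Finite G] {Y B : Subgroup G} [Y.Normal]
    {n : ℕ} (h : ∀ p : ℕ, p.Prime → p ∣ n → ∀ x ∈ B, x ^ p ∈ Y → x ∈ Y) :
    (Y.relIndex B).Coprime n := by
  refine Nat.coprime_of_dvd fun p hp h1 h2 => ?_
  have := Fact.mk hp
  obtain ⟨q, hq⟩ := exists_prime_orderOf_dvd_card' (G := B ⧸ Y.subgroupOf B) p h1
  obtain ⟨b, rfl⟩ := QuotientGroup.mk_surjective q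
  have h3 : ((b ^ p : B) : B ⧸ Y.subgroupOf B) = 1 := by
    rw [QuotientGroup.mk_pow, ← hq, pow_orderOf_eq_one]
  have h4 : (b : B ⧸ Y.subgroupOf B) = 1 := by
    rw [QuotientGroup.eq_one_iff] at h3 ⊢
    exact h p hp h2 b b.2 h3
  rw [h4, orderOf_one] at hq
  exact hp.one_lt.ne hq

/-- An element of B of prime order p ∣ n modulo Y would also have order dividing a power of m, which
is prime to p. -/
lemma coprime_relIndex_of_pow {G : Type u} [Group G] [Finite G] {Y B : Subgroup G} [Y.Normal]
    {m n : ℕ} (hmn : n.Coprime m) (h : ∀ x ∈ B, ∃ j : ℕ, x ^ m ^ j ∈ Y) :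
    (Y.relIndex B).Coprime n := by
  refine coprime_relIndex_of_forall fun p hp hpn x hx hxp => ?_
  obtain ⟨j, hj⟩ := h x hx
  rw [← QuotientGroup.eq_one_iff] at hj hxp ⊢
  rw [QuotientGroup.mk_pow] at hj hxp
  exact eq_one_of_pow_eq_one_of_coprime hxp hj ((hmn.coprime_dvd_left hpn).pow_right j)

/-- The Schur–Zassenhaus theorem for the section `(B ∩ L) / Y` of the group `L / Y`. -/
lemma exists_relative_complement {G : Type u} [Group G] [Finite G] {Y B L : Subgroup G}
    [Y.Normal] [B.Normal] (hYB : Y ≤ B) (hYL : Y ≤ L)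
    (hc : (Y.relIndex (B ⊓ L)).Coprime (B.relIndex L)) :
    ∃ T ≤ L, Y ≤ T ∧ T ⊓ B ≤ Y ∧ L ≤ B ⊔ T := by
  set q := QuotientGroup.mk' (Y.subgroupOf L)
  have hq : Function.Surjective q := QuotientGroup.mk'_surjective _
  have hker : q.ker = Y.subgroupOf L := QuotientGroup.ker_mk' _
  have hle : Y.subgroupOf L ≤ B.subgroupOf L := Subgroup.comap_mono hYB
  have : ((B.subgroupOf L).map q).Normal := Subgroup.Normal.map inferInstance _ hq
  have hcard : Nat.card ((B.subgroupOf L).map q) = Y.relIndex (B ⊓ L) := by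
    rw [← Subgroup.relIndex_ker, hker, ← Subgroup.inf_subgroupOf_right B L,
      Subgroup.relIndex_subgroupOf inf_le_right]
  have hidx : ((B.subgroupOf L).map q).index = B.relIndex L :=
    Subgroup.index_map_eq _ hq (hker.symm ▸ hle)
  obtain ⟨K, hK⟩ := Subgroup.exists_right_complement'_of_coprime
    (N := (B.subgroupOf L).map q) (by rwa [hcard, hidx])
  obtain ⟨h1, h2, h3⟩ := comap_mk_complement hle hK.disjoint.eq_bot hK.sup_eq_top
  refine ⟨(K.comap q).map L.subtype, Subgroup.map_subtype_le _, ?_, ?_, ?_⟩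
  · exact fun y hy => ⟨⟨y, hYL hy⟩, h1 hy, rfl⟩
  · rintro _ ⟨⟨x, hx, rfl⟩, hxB⟩
    exact h2 ⟨hx, hxB⟩
  · intro x hx
    obtain ⟨b, hb, t, ht, hbt⟩ := exists_mul_of_sup_eq h3 (Subgroup.mem_top (⟨x, hx⟩ : L))
    have : (b : G) * t = x := congrArg Subtype.val hbt
    rw [← this]
    exact Subgroup.mul_mem_sup hb ⟨t, ht, rfl⟩

/-- A complement `W` of `K` containing `D` can be replaced by one containing a larger normal
subgroup `Y` that centralizes `K`, if `Y / D` and `G / K Y` have coprime orders. -/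
lemma exists_complement_ge {G : Type u} [Group G] [Finite G] {K W D Y : Subgroup G}
    [K.Normal] [D.Normal] [Y.Normal] (h1 : K ⊓ W = ⊥) (h2 : K ⊔ W = ⊤) (hDW : D ≤ W)
    (hDY : D ≤ Y) (hYC : Y ≤ Subgroup.centralizer (K : Set G)) (hYK : K ⊓ Y = ⊥) {m : ℕ}
    (hpow : ∀ y ∈ Y, ∃ j : ℕ, y ^ m ^ j ∈ D) (hm : (K ⊔ Y).index.Coprime m) :
    ∃ W' : Subgroup G, K ⊓ W' = ⊥ ∧ K ⊔ W' = ⊤ ∧ Y ≤ W' := by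
  -- If ky lies in W, then so does its m^j-th power; as y^(m^j) is in D ≤ W for suitable j, k^(m^j)
  -- lies in K ∩ W = 1. Hence (KY ∩ W)/D consists of elements of m-power order.
  have hcop : (D.relIndex ((K ⊔ Y) ⊓ W)).Coprime ((K ⊔ Y).relIndex W) := by
    refine coprime_relIndex_of_pow
      (hm.coprime_dvd_left (Subgroup.relIndex_dvd_index_of_normal _ _)) ?_
    rintro a ⟨ha, haW⟩
    obtain ⟨k, hk, y, hy, rfl⟩ := Subgroup.mem_sup_of_normal_left.1 ha
    obtain ⟨j, hj⟩ := hpow y hy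
    refine ⟨j, ?_⟩
    have hcomm : Commute k y := Subgroup.mem_centralizer_iff.1 (hYC hy) k hk
    have h3 := W.pow_mem haW (m ^ j)
    rw [hcomm.mul_pow] at h3 ⊢
    have h4 : k ^ m ^ j = 1 := eq_one_of_mem_of_inf_eq_bot h1 (K.pow_mem hk _)
      ((W.mul_mem_cancel_right (hDW hj)).1 h3)
    rwa [h4, one_mul]
  obtain ⟨T, hTW, hDT, hT1, hT2⟩ := exists_relative_complement (hDY.trans le_sup_right) hDW hcop
  refine ⟨T ⊔ Y, ?_, ?_, le_sup_right⟩
  · rw [eq_bot_iff]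
    rintro x ⟨hxK, hx⟩
    obtain ⟨t, ht, y, hy, rfl⟩ := Subgroup.mem_sup_of_normal_right.1 hx
    have htB : t ∈ K ⊔ Y := by
      rw [← mul_inv_cancel_right t y]
      exact Subgroup.mul_mem_sup hxK (Y.inv_mem hy)
    exact hYK ▸ Subgroup.mem_inf.2 ⟨hxK, Y.mul_mem (hDY (hT1 ⟨ht, htB⟩)) hy⟩
  · rw [← top_le_iff, ← h2]
    refine sup_le le_sup_left (hT2.trans (sup_le (sup_le le_sup_left ?_) ?_))
    · exact le_sup_of_le_right le_sup_right
    · exact le_sup_of_le_right le_sup_left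

/-- The elements of `C` with some `m`-power power in `D`, where `C / D` is abelian. -/
def powerRadical {G : Type u} [Group G] (C D : Subgroup G) [D.Normal] (hCD : ⁅C, C⁆ ≤ D) (m : ℕ) :
    Subgroup G where
  carrier := {c | c ∈ C ∧ ∃ j : ℕ, c ^ m ^ j ∈ D}
  one_mem' := ⟨C.one_mem, 0, by simp⟩
  mul_mem' := by
    rintro a b ⟨ha, i, hi⟩ ⟨hb, j, hj⟩
    refine ⟨C.mul_mem ha hb, i + j, ?_⟩
    have hcomm : Commute (a : G ⧸ D) (b : G ⧸ D) := by
      rw [← commutatorElement_eq_one_iff_commute]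
      exact (QuotientGroup.eq_one_iff _).2 (hCD (Subgroup.commutator_mem_commutator ha hb))
    rw [← QuotientGroup.eq_one_iff] at hi hj ⊢
    rw [QuotientGroup.mk_pow] at hi hj ⊢
    rw [QuotientGroup.mk_mul, hcomm.mul_pow, pow_add, pow_mul, hi, one_pow, one_mul, mul_comm,
      pow_mul, hj, one_pow]
  inv_mem' := by
    rintro a ⟨ha, i, hi⟩
    exact ⟨C.inv_mem ha, i, inv_pow a _ ▸ D.inv_mem hi⟩

instance powerRadical_normal {G : Type u} [Group G] (C D : Subgroup G) [hC : C.Normal]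
    [hD : D.Normal] (hCD : ⁅C, C⁆ ≤ D) (m : ℕ) : (powerRadical C D hCD m).Normal := by
  refine ⟨?_⟩
  rintro a ⟨ha, i, hi⟩ g
  exact ⟨hC.conj_mem a ha g, i, conj_pow (a := g) (b := a) ▸ hD.conj_mem _ hi g⟩

/-- For p ∣ m, an element whose p-th power has m-power order modulo D has m-power order itself. -/
lemma coprime_relIndex_powerRadical {G : Type u} [Group G] [Finite G] (C D : Subgroup G)
    [C.Normal] [D.Normal] (hCD : ⁅C, C⁆ ≤ D) (m : ℕ) :
    ((powerRadical C D hCD m).relIndex C).Coprime m := by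
  refine coprime_relIndex_of_forall ?_
  rintro p - ⟨r, hr⟩ x hx ⟨-, j, hj⟩
  refine ⟨hx, j + 1, ?_⟩
  have : x ^ m ^ (j + 1) = ((x ^ p) ^ m ^ j) ^ r := by
    rw [← pow_mul, ← pow_mul, pow_succ]
    nth_rewrite 2 [hr]
    ring_nf
  rw [this]
  exact D.pow_mem hj r

/-! ### Characteristic subgroups of order coprime to |Z(N)| |Out(N)|. -/

theorem hasComplement_of_coprime {G : Type u} [Group G] [Finite G] {M N : Subgroup G} [M.Normal]
    [N.Normal] (hMN : M ≤ N)
    (hZ : (Nat.card M).Coprime (Nat.card ↥(N ⊓ Subgroup.centralizer (N : Set G))))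
    (hO : (Nat.card M).Coprime (N ⊔ Subgroup.centralizer (N : Set G)).index)
    (h : GaschuetzHolds (N.map (QuotientGroup.mk' M))) {H J : Subgroup G}
    (hc : (Nat.card N).Coprime H.index) (h1 : N ⊓ J = ⊥) (h2 : N ⊔ J = H) : HasComplement N := by
  set C : Subgroup G := Subgroup.centralizer (N : Set G) with hC
  set m := Nat.card M with hm
  set q := QuotientGroup.mk' M
  have hq : Function.Surjective q := QuotientGroup.mk'_surjective M
  have hCN : ∀ c ∈ C, ∀ n ∈ N, Commute n c := fun c hc n hn => Subgroup.mem_centralizer_iff.1 hc n hn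
  have hNq : (N.map q).Normal := Subgroup.Normal.map ‹_› _ hq
  obtain ⟨W₀, hW₀, hW₀'⟩ := exists_complement_map_mk hMN h hc h1 h2
  obtain ⟨W, hW1, hW2, hW3⟩ := h.exists_complement_commutator_le hW₀ hW₀'
  have hCq : C.map q ≤ Subgroup.centralizer (N.map q : Set (G ⧸ M)) := by
    rintro _ ⟨c, hc, rfl⟩
    rw [Subgroup.mem_centralizer_iff]
    rintro _ ⟨n, hn, rfl⟩
    exact (hCN c hc n hn).map q
  let D : Subgroup G := ⁅C, C⁆
  have hDC : D ≤ C := Subgroup.commutator_le_left C C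
  have hDW : D.map q ≤ W := by
    rw [Subgroup.map_commutator]
    exact (Subgroup.commutator_mono hCq hCq).trans hW3
  -- The image of x lies in both N/M and its complement, so x is in M; it is also in Z(N), of
  -- coprime order.
  have hDN : ∀ x ∈ D, x ∈ N → x = 1 := by
    intro x hxD hxN
    have h3 : q x = 1 := eq_one_of_mem_of_inf_eq_bot hW1 (Subgroup.mem_map_of_mem q hxN)
      (hDW (Subgroup.mem_map_of_mem q hxD))
    have h4 : x ∈ M := (QuotientGroup.eq_one_iff x).1 h3
    exact eq_one_of_pow_eq_one_of_coprime (pow_card_eq_one_of_mem h4)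
      (pow_card_eq_one_of_mem (Subgroup.mem_inf.2 ⟨hxN, hDC hxD⟩)) hZ
  let Y : Subgroup G := powerRadical C D le_rfl m
  have hYC : Y ≤ C := fun y hy => hy.1
  have hDY : D ≤ Y := fun x hx => ⟨hDC hx, 0, by simpa using hx⟩
  have hYN : ∀ y ∈ Y, y ∈ N → y = 1 := by
    rintro y ⟨hyC, j, hj⟩ hyN
    exact eq_one_of_pow_eq_one_of_coprime (hDN _ hj (N.pow_mem hyN _))
      (pow_card_eq_one_of_mem (Subgroup.mem_inf.2 ⟨hyN, hyC⟩)) (hZ.pow_left j)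
  -- |G : NY| = |NC : NY| |G : NC|, where the first factor divides |C : Y|.
  have hidx : (N ⊔ Y).index.Coprime m := by
    have hle : N ⊔ Y ≤ N ⊔ C := sup_le_sup_left hYC N
    rw [← Subgroup.relIndex_mul_index hle]
    refine Nat.Coprime.mul_left ?_ hO.symm
    have h3 : N ⊔ C = C ⊔ (N ⊔ Y) := by
      rw [sup_comm N Y, ← sup_assoc, sup_eq_left.2 hYC, sup_comm]
    rw [h3, Subgroup.relIndex_sup_right]
    exact (coprime_relIndex_powerRadical C D le_rfl m).coprime_dvd_left
      (Subgroup.relIndex_dvd_of_le_left C le_sup_right)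
  have hDq : (D.map q).Normal := Subgroup.Normal.map inferInstance _ hq
  have hYq : (Y.map q).Normal := Subgroup.Normal.map inferInstance _ hq
  obtain ⟨V, hV1, hV2, hV3⟩ := exists_complement_ge (m := m) hW1 hW2 hDW (Subgroup.map_mono hDY)
    ((Subgroup.map_mono hYC).trans hCq) (by
      rw [eq_bot_iff]
      rintro _ ⟨⟨n, hn, rfl⟩, y, hy, hyn⟩
      have h3 : n⁻¹ * y ∈ M := QuotientGroup.eq.1 hyn.symm
      have h4 : y ∈ N := (N.mul_mem_cancel_left (N.inv_mem hn)).1 (hMN h3)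
      rw [Subgroup.mem_bot, ← hyn, hYN y hy h4, map_one]) (by
      rintro _ ⟨y, ⟨hy, j, hj⟩, rfl⟩
      exact ⟨j, map_pow q y _ ▸ Subgroup.mem_map_of_mem q hj⟩) (by
      rw [← Subgroup.map_sup]
      exact hidx.coprime_dvd_left (Subgroup.index_map_dvd _ hq))
  obtain ⟨hL1, hL2, hL3⟩ := comap_mk_complement hMN hV1 hV2
  set L : Subgroup G := V.comap q
  have hYL : Y ≤ L := fun y hy => hV3 (Subgroup.mem_map_of_mem q hy)
  -- Since L ∩ N ≤ M and Y ≤ L, Dedekind's law gives NY ∩ L ≤ MY, so |L : MY ∩ L| divides |G : NY|.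
  have hcop : (Y.relIndex ((M ⊔ Y) ⊓ L)).Coprime ((M ⊔ Y).relIndex L) := by
    refine coprime_relIndex_of_pow (m := m) (hidx.coprime_dvd_left ?_) ?_
    · refine Nat.dvd_trans ?_ (Subgroup.relIndex_dvd_index_of_normal (N ⊔ Y) L)
      rw [← Subgroup.inf_relIndex_right (N ⊔ Y) L]
      refine Subgroup.relIndex_dvd_of_le_left L ?_
      rintro x ⟨hx, hxL⟩
      obtain ⟨n, hn, y, hy, rfl⟩ := Subgroup.mem_sup_of_normal_left.1 hx
      exact Subgroup.mul_mem_sup (hL2 ⟨(L.mul_mem_cancel_right (hYL hy)).1 hxL, hn⟩) hy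
    · rintro x ⟨hx, -⟩
      obtain ⟨a, ha, y, hy, rfl⟩ := Subgroup.mem_sup_of_normal_left.1 hx
      refine ⟨1, ?_⟩
      rw [pow_one, (hCN y (hYC hy) a (hMN ha)).mul_pow, pow_card_eq_one_of_mem ha, one_mul]
      exact Y.pow_mem hy m
  obtain ⟨T, hTL, hYT, hT1, hT2⟩ := exists_relative_complement le_sup_right hYL hcop
  refine hasComplement_of_supplement (Q := T) hMN hL2 hL3 ?_ (le_antisymm (sup_le hL1 hTL) ?_)
  · rw [eq_bot_iff]
    rintro x ⟨hxM, hxT⟩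
    exact hYN x (hT1 ⟨hxT, (le_sup_left : M ≤ M ⊔ Y) hxM⟩) (hMN hxM)
  · exact hT2.trans (sup_le (sup_le le_sup_left (le_sup_of_le_right hYT)) le_sup_right)

lemma card_inf_centralizer_range_dvd {N G : Type u} [Group N] [Group G] {f : N →* G}
    (hf : Function.Injective f) :
    Nat.card ↥(f.range ⊓ Subgroup.centralizer (f.range : Set G)) ∣
      Nat.card (Subgroup.center N) := by
  refine (Subgroup.card_dvd_of_le (K := (Subgroup.center N).map f) ?_).trans
    (Subgroup.card_map_dvd _ f)
  rintro _ ⟨⟨x, rfl⟩, hx⟩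
  refine ⟨x, Subgroup.mem_center_iff.2 fun g => hf ?_, rfl⟩
  rw [map_mul, map_mul]
  exact Subgroup.mem_centralizer_iff.1 hx _ ⟨g, rfl⟩

/-- If `N` is normal in `G` then `G / N C_G(N)` embeds into `Out(N)`. -/
lemma index_sup_centralizer_dvd {N G : Type u} [Group N] [Group G] {f : N →* G}
    (hf : Function.Injective f) [hn : f.range.Normal] :
    (f.range ⊔ Subgroup.centralizer (f.range : Set G)).index ∣ Nat.card (Out N) := by
  let e := MonoidHom.ofInjective hf
  let ψ : G →* MulAut N := (MulAut.congr e.symm).toMonoidHom.comp MulAut.conjNormal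
  have hψ : ∀ g x, f (ψ g x) = g * f x * g⁻¹ := by
    intro g x
    have h1 : e (ψ g x) = MulAut.conjNormal g (e x) := e.apply_symm_apply _
    have h2 := congrArg Subtype.val h1
    rwa [MulAut.conjNormal_apply] at h2
  have hker : ((QuotientGroup.mk' (Inn N)).comp ψ).ker ≤
      f.range ⊔ Subgroup.centralizer (f.range : Set G) := by
    intro g hg
    obtain ⟨n, hng⟩ := (QuotientGroup.eq_one_iff (ψ g)).1 hg
    rw [← mul_inv_cancel_left (f n) g]
    refine Subgroup.mul_mem_sup ⟨n, rfl⟩ (Subgroup.mem_centralizer_iff.2 ?_)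
    rintro _ ⟨x, rfl⟩
    have h1 := hψ g x
    rw [← hng, MulAut.conj_apply, map_mul, map_mul, map_inv] at h1
    calc f x * ((f n)⁻¹ * g) = (f n)⁻¹ * (f n * f x * (f n)⁻¹) * g := by group
      _ = (f n)⁻¹ * g * f x := by rw [h1]; group
  refine (Subgroup.index_dvd_of_le hker).trans ?_
  rw [Subgroup.index_ker]
  exact Subgroup.card_subgroup_dvd_card _

/-- The hypotheses on Z(N) and Out(N) become conditions inside G: N ∩ C_G(N) is the centre of N, and
G/N C_G(N) embeds into Out(N). -/
theorem gaschuetzHolds_of_coprime {N : Type u} [Group N] (M : Subgroup N)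
    [M.Characteristic]
    (hM : (Nat.card M).Coprime (Nat.card (Subgroup.center N) * Nat.card (Out N)))
    (h : GaschuetzHolds (N ⧸ M)) : GaschuetzHolds N := by
  refine gaschuetzHolds_of_forall fun G _ _ f hf hn H J hc h1 h2 => ?_
  have hMn := normal_map_of_characteristic hf hn M
  have hcard : Nat.card (M.map f) = Nat.card M :=
    Nat.card_congr (M.equivMapOfInjective f hf).toEquiv.symm
  refine hasComplement_of_coprime (Subgroup.map_le_range f M) ?_ ?_
    (h.of_mulEquiv (quotientEquivMapMk hf M)) hc h1 h2
  · rw [hcard]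
    exact hM.coprime_mul_right_right.coprime_dvd_right (card_inf_centralizer_range_dvd hf)
  · rw [hcard]
    exact hM.coprime_mul_left_right.coprime_dvd_right (index_sup_centralizer_dvd hf)

theorem mainTheorem8 :
    (∀ (k : ℕ) (N : Fin k → Type u) [∀ i, Group (N i)] [∀ i, Finite (N i)],
      RoseCriterion (∀ i, N i) ↔ ∀ i, RoseCriterion (N i)) ∧
    (∀ (N : Type u) [Group N] [Finite N] (k : ℕ) (F : Fin k → Subgroup N),
      IsInternalDirectProduct F → (∀ i, (F i).Characteristic) →
      (∀ i, GaschuetzHolds (F i)) → GaschuetzHolds N) ∧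
    (∀ (N : Type u) [Group N] [Finite N] (M : Subgroup N) [M.Characteristic],
      RoseCriterion M → GaschuetzHolds (N ⧸ M) → GaschuetzHolds N) ∧
    (∀ (N : Type u) [Group N] [Finite N] (M : Subgroup N) [M.Characteristic],
      (Nat.card M).Coprime (Nat.card (Subgroup.center N) * Nat.card (Out N)) →
      AllSylowAbelian M → HasComplement M → GaschuetzHolds (N ⧸ M) → GaschuetzHolds N) :=
  ⟨fun _ N _ _ => roseCriterion_pi_iff N,
    fun _ _ _ _ F hF hchar h => gaschuetzHolds_of_isInternalDirectProduct F hF hchar h,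
    fun _ _ _ M _ hM h => gaschuetzHolds_of_roseCriterion M hM h,
    fun _ _ _ M _ hM _ _ h => gaschuetzHolds_of_coprime M hM h⟩
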